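/- Let $n\ge 2$, let $J=\mathrm{Diag}(\varepsilon_1,\dots,\varepsilon_n)$ with $\varepsilon_i\in\{1,-1\}$ (for example $J=\mathrm{Diag}(I_p,-I_{n-p})$), and let $\mathcal J=\{X\in\mathbb R^{n\times n}: X^{\top}JX=J\}$. Write $\|\cdot\|_F$ for the Frobenius norm, $\langle A,B\rangle=\mathrm{tr}(A^\top B)$, and $\|A\|_M^2=\mathrm{vec}(A)^\top M\,\mathrm{vec}(A)$. Let $f:\mathbb R^{n\times n}\to\mathbb R$ be continuously differentiable and coercive ($f(X)\to\infty$ as $\|X\|_F\to\infty$), and suppose that for some symmetric positive semidefinite $H\in\mathbb R^{n^2\times n^2}$ with spectral norm $\|H\|\le L_f$, $L_f>0$, $$f(X^+)\le f(X)+\langle X^+-X,\nabla f(X)\rangle+\tfrac12\|X^+-X\|_H^2\qquad\text{for all }X,X^+.$$ **GS-JOBCD.** Fix $\theta>0$ and $X^0\in\mathcal J$. For $t=0,1,2,\dots$: draw a pair $B=B^t$ of distinct indices from $\{1,\dots,n\}$ uniformly among the $\binom n2$ pairs, independently of the other draws. Let $U_B\in\mathbb R^{n\times2}$ be the matrix for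 which $U_B^\top X$ consists of the rows of $X$ indexed by $B$. Put $Z=U_B^\top X^t$ and $\underline Q=(Z^\top\otimes U_B)^\top H(Z^\top\otimes U_B)$, and choose $Q=\underline Q$ or $Q=\varsigma I_4$ with $\|\underline Q\|\le\varsigma\le L_f$. Let $V^t$ be a global minimizer of $$f(X^t)+\tfrac12\|V-I\|^2_{Q+\theta I}+\langle V-I,[\nabla f(X^t)(X^t)^\top]_{BB}\rangle$$ over $V\in\mathbb R^{2\times 2}$ with $V^\top J_{BB}V=J_{BB}$ (which minimizer is taken may depend on $B^0,\dots,B^t$ but not on later draws), and set $X^{t+1}=X^t+U_B(V^t-I)U_B^\top X^t$. **KL assumption.** Let $f^\circ=f+\mathcal I_{\mathcal J}$, where $\mathcal I_{\mathcal J}$ is $0$ on $\mathcal J$ and $+\infty$ elsewhere, and let $\partial f^\circ$ be its limiting subdifferential. For $\sigma\in[0,1)$ and $c>0$ say that $f^\circ$ has the KL property at $X\in\mathcal J$ with exponent $\sigma$ and constant $c$ if, with $\varphi(s)=cs^{1-\sigma}$, there are $\eta\in(0,+\infty]$ and a neighbourhood $\Upsilon$ of $X$ such that $\mathrm{dist}(0,\partial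 f^\circ(X'))\,\varphi'(f^\circ(X')-f^\circ(X))\ge1$ for all $X'\in\Upsilon$ with $f^\circ(X)<f^\circ(X')<f^\circ(X)+\eta$. Assume that $f^\circ$ is a KL function, i.e. at every $X\in\mathcal J$ it has the KL property with some exponent in $[0,1)$ and some constant. **Conclusion.** Almost surely $\sum_{i\ge0}\|V^i-I\|_F<\infty$ and $X^t$ converges to some $X^\infty$. Moreover: (a) For every $\sigma\in(\frac14,\frac12]$ and $c>0$ there is a deterministic $\gamma>0$ such that, almost surely, if $f^\circ$ has the KL property at $X^\infty$ with exponent $\sigma$ and constant $c$, then there are $t'$ and $C$ (which may depend on the realization) with $\|X^t-X^\infty\|_F\le C\exp(-\gamma t)$ for all $t\ge t'$. (b) For every $\sigma\in(\frac12,1)$, almost surely, if $f^\circ$ has the KL property at $X^\infty$ with exponent $\sigma$ (and some constant), then there are $t'$ and $C$ (which may depend on the realization) with $\|X^t-X^\infty\|_F\le C\,t^{-1/\tau}$ for all $t\ge t'$, where $\tau=\frac{2\sigma-1}{1-\sigma}$. -/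

import Mathlib

open MeasureTheory ProbabilityTheory Filter Set
open scoped Matrix Topology Kronecker

attribute [local instance] Matrix.frobeniusNormedAddCommGroup Matrix.frobeniusNormedSpace

namespace JOBCD

/-- Real `n × n` matrices. The norm `‖X‖` is the Frobenius norm throughout. -/
abbrev Mat (n : ℕ) : Type := Matrix (Fin n) (Fin n) ℝ

/-- The inner product `⟨A, B⟩ = tr (Aᵀ B)`, the one that induces the Frobenius norm. -/
noncomputable def frobInner {n : ℕ} (A B : Mat n) : ℝ := (Aᵀ * B).trace

/-- `‖A‖_M² = vec(A)ᵀ M vec(A)`, where `vec` stacks the columns. -/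
noncomputable def quadForm {n : ℕ} (M : Matrix (Fin n × Fin n) (Fin n × Fin n) ℝ) (A : Mat n) : ℝ :=
  A.vec ⬝ᵥ (M *ᵥ A.vec)

/-- The spectral norm of a square matrix. -/
noncomputable def specNorm {ι : Type*} [Fintype ι] [DecidableEq ι] (M : Matrix ι ι ℝ) : ℝ :=
  ‖Matrix.toEuclideanCLM (n := ι) (𝕜 := ℝ) M‖

/-- The Euclidean gradient of `f` at `X`: the matrix of the partial derivatives. -/
noncomputable def matGrad {n : ℕ} (f : Mat n → ℝ) (X : Mat n) : Mat n :=
  Matrix.of fun i j => fderiv ℝ f X (Matrix.single i j 1)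

/-- The matrices `X` with `Xᵀ J X = J`. -/
def JOrth {n : ℕ} (J : Mat n) : Set (Mat n) := {X | Xᵀ * J * X = J}

/-! ### Blocks -/

/-- A block: a choice of two distinct indices out of `n`, listed in increasing order. -/
abbrev Block (n : ℕ) : Type := {b : Fin n × Fin n // b.1 < b.2}

/-- The two indices of a block. -/
def Block.idx {n : ℕ} (b : Block n) : Fin 2 → Fin n := ![b.1.1, b.1.2]

/-- The `n × 2` selection matrix `U_B`, so that `U_Bᵀ X` consists of the rows of `X` in `B`. -/
def Block.U {n : ℕ} (b : Block n) : Matrix (Fin n) (Fin 2) ℝ :=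
  Matrix.of fun j i => if b.idx i = j then 1 else 0

/-- The principal `2 × 2` submatrix `W_BB`. -/
def Block.sub {n : ℕ} (b : Block n) (W : Mat n) : Mat 2 := W.submatrix b.idx b.idx

/-! ### The subproblem -/

/-- `(Zᵀ ⊗ U_B)ᵀ H (Zᵀ ⊗ U_B)` with `Z = U_Bᵀ X`, a `4 × 4` matrix. -/
noncomputable def Qlow {n : ℕ} (H : Matrix (Fin n × Fin n) (Fin n × Fin n) ℝ) (X : Mat n)
    (b : Block n) : Matrix (Fin 2 × Fin 2) (Fin 2 × Fin 2) ℝ :=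
  ((b.Uᵀ * X)ᵀ ⊗ₖ b.U)ᵀ * H * ((b.Uᵀ * X)ᵀ ⊗ₖ b.U)

/-- The matrices `Q` that the algorithm may use at `X` for the block `b`. -/
def AdmissibleQ {n : ℕ} (H : Matrix (Fin n × Fin n) (Fin n × Fin n) ℝ) (L : ℝ) (X : Mat n)
    (b : Block n) (Q : Matrix (Fin 2 × Fin 2) (Fin 2 × Fin 2) ℝ) : Prop :=
  Q = Qlow H X b ∨ ∃ ς : ℝ, specNorm (Qlow H X b) ≤ ς ∧ ς ≤ L ∧ Q = ς • 1

/-- The majorization function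
`G(V; X, B) = f(X) + ½ ‖V - I‖²_{Q + θ I} + ⟨V - I, [∇f(X) Xᵀ]_BB⟩`. -/
noncomputable def majorizer {n : ℕ} (f : Mat n → ℝ) (θ : ℝ)
    (Q : Matrix (Fin 2 × Fin 2) (Fin 2 × Fin 2) ℝ) (X : Mat n) (b : Block n) (V : Mat 2) : ℝ :=
  f X + (1 / 2) * quadForm (Q + θ • 1) (V - 1) + frobInner (V - 1) (b.sub (matGrad f X * Xᵀ))

/-! ### The algorithm -/

/-- `(B, V, X)` is a run of GS-JOBCD from `X₀`: the blocks are independent and uniformly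
distributed, `V t` is a global minimizer of the subproblem over the J-orthogonal `2 × 2` matrices
(which minimizer is taken may depend on the blocks drawn so far, not on later ones),
and `X (t + 1)` replaces the rows of `X t` in the block by `V t` times these rows. -/
structure IsGSJOBCD {n : ℕ} {Ω : Type*} [MeasurableSpace Ω] (μ : Measure Ω)
    (J : Mat n) (f : Mat n → ℝ) (H : Matrix (Fin n × Fin n) (Fin n × Fin n) ℝ) (L θ : ℝ)
    (X₀ : Mat n) (B : ℕ → Ω → Block n) (V : ℕ → Ω → Mat 2) (X : ℕ → Ω → Mat n) : Prop where
  measurable_block : ∀ t, Measurable (B t)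
  indep_block : iIndepFun B μ
  uniform_block : ∀ t b, μ.real (B t ⁻¹' {b}) = 1 / (n.choose 2 : ℝ)
  history : ∀ t ω ω', (∀ s ≤ t, B s ω = B s ω') → V t ω = V t ω'
  init : ∀ ω, X 0 ω = X₀
  mem : ∀ t ω, V t ω ∈ JOrth ((B t ω).sub J)
  isMin : ∀ t ω, ∃ Q, AdmissibleQ H L (X t ω) (B t ω) Q ∧
    IsMinOn (majorizer f θ Q (X t ω) (B t ω)) (JOrth ((B t ω).sub J)) (V t ω)
  step : ∀ t ω, X (t + 1) ω
    = X t ω + (B t ω).U * (V t ω - 1) * (B t ω).Uᵀ * X t ω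

/-! ### The Kurdyka-Łojasiewicz property -/

/-- `f + I_C`, where `I_C` is `0` on `C` and `+∞` elsewhere. -/
noncomputable def addIndicator {n : ℕ} (f : Mat n → ℝ) (C : Set (Mat n)) (X : Mat n) : EReal :=
  open Classical in if X ∈ C then (f X : EReal) else ⊤

/-- The Fréchet (regular) subdifferential of an extended-real-valued function:
all `G` with `F Y ≥ F X + ⟨G, Y - X⟩ - o(‖Y - X‖)` as `Y → X`, at points where `F` is finite. -/
def frechetSubdiff {n : ℕ} (F : Mat n → EReal) (X : Mat n) : Set (Mat n) :=
  {G | F X ≠ ⊤ ∧ F X ≠ ⊥ ∧ ∀ ε : ℝ, 0 < ε → ∀ᶠ Y in 𝓝 X,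
    (((F X).toReal + frobInner G (Y - X) - ε * ‖Y - X‖ : ℝ) : EReal) ≤ F Y}

/-- The limiting (Mordukhovich) subdifferential. -/
def limitingSubdiff {n : ℕ} (F : Mat n → EReal) (X : Mat n) : Set (Mat n) :=
  {G | F X ≠ ⊤ ∧ F X ≠ ⊥ ∧ ∃ (Y : ℕ → Mat n) (S : ℕ → Mat n),
    Tendsto Y atTop (𝓝 X) ∧ Tendsto (fun k => F (Y k)) atTop (𝓝 (F X)) ∧
    (∀ k, S k ∈ frechetSubdiff F (Y k)) ∧ Tendsto S atTop (𝓝 G)}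

/-- The Kurdyka-Łojasiewicz inequality for `F` at `X` with desingularization function
`φ(s) = c s^{1-σ}`: for some `η ∈ (0, +∞]` and some neighbourhood of `X`, all its points `X'` with
`F X < F X' < F X + η` satisfy `dist(0, ∂F(X')) φ'(F X' - F X) ≥ 1`. -/
def HasKL {n : ℕ} (F : Mat n → EReal) (σ c : ℝ) (X : Mat n) : Prop :=
  ∃ η : EReal, 0 < η ∧ ∃ N ∈ 𝓝 X, ∀ X' ∈ N, F X < F X' → F X' < F X + η →
    1 ≤ Metric.infDist 0 (limitingSubdiff F X')
      * deriv (fun s : ℝ => c * s ^ (1 - σ)) ((F X').toReal - (F X).toReal)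

/-- `F` is a KL function: at every point of its domain the Kurdyka-Łojasiewicz inequality holds with
some exponent `σ ∈ [0, 1)` and some `c > 0`. -/
def IsKLFunction {n : ℕ} (F : Mat n → EReal) : Prop :=
  ∀ X, F X ≠ ⊤ → ∃ σ ∈ Ico (0 : ℝ) 1, ∃ c : ℝ, 0 < c ∧ HasKL F σ c X

end JOBCD

/-! Comparing the minimizer `V` with the feasible `V = I` gives sufficient decrease: each step
lowers `f` by at least `θ/2 * ‖V - I‖²` (`descent`). The converse estimate, that the subdifferential
is no farther from `0` than a multiple of the step, cannot hold at every time, because the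
first-order condition at `V` sees only the one skew entry of `J ∇f(X) Xᵀ` that belongs to the drawn
block.

To recover it, call a time good if the drawn block is the one that, given the history, produces the
longest step (`IsGSJOBCD.exists_argmax`). At a good time the step taken dominates those of all other
blocks, so it bounds every skew entry and hence the distance of `0` to the subdifferential
(`infDist_limitingSubdiff_le`). The candidate block depends on the past only, so good times are
pairwise independent events of probability `1 / (n choose 2)`, and by the strong law they almost
surely have positive density (`ae_eventually_le_sum_indicator`).

At good times KL turns the decrease into `Δ' ≤ Δ - a Δ^(2σ)` for the gap `Δ`; at other times `Δ`
does not grow. So `Δ` decays geometrically (`σ = 1/2`) or like `t^(-1/(2σ-1))` (`σ > 1/2`). As KL is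
exploited only at good times, step lengths are not summed by telescoping the desingularizing
function: the tails come from `d² ≤ (2/θ)(Δ_t - Δ_{t+1})` and the rate of `Δ`. Before a limit is
known, compactness supplies one exponent valid along the whole trajectory
(`IsKLFunction.exists_eventually_rpow_le`). -/

namespace JOBCD

/-! ### Frobenius and spectral norm estimates -/

section LinearAlgebra

variable {m n : ℕ}

theorem norm_toLp_vec (A : Matrix (Fin m) (Fin n) ℝ) :
    ‖(WithLp.toLp 2 A.vec : EuclideanSpace ℝ (Fin n × Fin m))‖ = ‖A‖ := by
  rw [EuclideanSpace.norm_eq, Matrix.frobenius_norm_def, Real.sqrt_eq_rpow, Fintype.sum_prod_type,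
    Finset.sum_comm]
  simp [Matrix.vec]

theorem abs_vec_dotProduct_le (A B : Matrix (Fin m) (Fin n) ℝ) :
    |A.vec ⬝ᵥ B.vec| ≤ ‖A‖ * ‖B‖ := by
  have h := abs_real_inner_le_norm (WithLp.toLp 2 B.vec : EuclideanSpace ℝ (Fin n × Fin m))
    (WithLp.toLp 2 A.vec)
  rw [norm_toLp_vec, norm_toLp_vec, EuclideanSpace.inner_eq_star_dotProduct] at h
  simpa [mul_comm] using h

theorem abs_vec_dotProduct_mulVec_le
    (M : Matrix (Fin n × Fin m) (Fin n × Fin m) ℝ) (A B : Matrix (Fin m) (Fin n) ℝ) :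
    |A.vec ⬝ᵥ (M *ᵥ B.vec)| ≤ specNorm M * ‖A‖ * ‖B‖ := by
  have h := abs_real_inner_le_norm
    (Matrix.toEuclideanCLM (n := Fin n × Fin m) (𝕜 := ℝ) M (WithLp.toLp 2 B.vec))
    (WithLp.toLp 2 A.vec)
  have h2 := (Matrix.toEuclideanCLM (n := Fin n × Fin m) (𝕜 := ℝ) M).le_opNorm
    (WithLp.toLp 2 B.vec)
  rw [norm_toLp_vec] at h h2
  rw [EuclideanSpace.inner_eq_star_dotProduct] at h
  simp only [star_trivial, Matrix.ofLp_toEuclideanCLM] at h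
  calc _ ≤ _ := h
    _ ≤ (specNorm M * ‖B‖) * ‖A‖ := by gcongr; exact h2
    _ = _ := by ring

theorem frobInner_eq_vec_dotProduct (A B : Mat n) : frobInner A B = A.vec ⬝ᵥ B.vec := by
  rw [Matrix.vec_dotProduct_vec, frobInner]

theorem abs_frobInner_le (A B : Mat n) : |frobInner A B| ≤ ‖A‖ * ‖B‖ := by
  rw [frobInner_eq_vec_dotProduct]; exact abs_vec_dotProduct_le A B

theorem vec_dotProduct_self (A : Matrix (Fin m) (Fin n) ℝ) : A.vec ⬝ᵥ A.vec = ‖A‖ ^ 2 := by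
  rw [← norm_toLp_vec, EuclideanSpace.norm_sq_eq]
  simp [dotProduct, pow_two]

theorem norm_le_of_abs_entry_le (A : Mat n) {c : ℝ} (h : ∀ i j, |A i j| ≤ c) : ‖A‖ ≤ n * c := by
  rcases Nat.eq_zero_or_pos n with rfl | hn
  · have : A = 0 := by ext i; exact i.elim0
    simp [this]
  have hc : 0 ≤ c := (abs_nonneg _).trans (h ⟨0, hn⟩ ⟨0, hn⟩)
  refine abs_le_of_sq_le_sq' ?_ (by positivity) |>.2
  rw [← vec_dotProduct_self]
  have : ∀ p ∈ (Finset.univ : Finset (Fin n × Fin n)), A.vec p * A.vec p ≤ c ^ 2 := by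
    intro p _
    have := sq_le_sq' (neg_le_of_abs_le (h p.2 p.1)) (le_of_abs_le (h p.2 p.1))
    simpa [Matrix.vec, pow_two] using this
  refine (Finset.sum_le_card_nsmul _ _ _ this).trans (le_of_eq ?_)
  simp; ring

theorem specNorm_nonneg {ι : Type*} [Fintype ι] [DecidableEq ι] (M : Matrix ι ι ℝ) :
    0 ≤ specNorm M := norm_nonneg _

end LinearAlgebra

/-! ### Block updates: feasibility and sufficient decrease -/

section Blocks

variable {n : ℕ}

theorem Block.idx_injective (b : Block n) : Function.Injective b.idx := by
  have h := b.2
  intro i j hij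
  fin_cases i <;> fin_cases j <;> simp_all [Block.idx]

theorem Block.transpose_U_mul_mul_U (b : Block n) (W : Mat n) : b.Uᵀ * W * b.U = b.sub W := by
  ext i j
  simp [Block.U, Block.sub, Matrix.mul_apply]

theorem Block.sub_diagonal (b : Block n) (ε : Fin n → ℝ) :
    b.sub (Matrix.diagonal ε) = Matrix.diagonal (ε ∘ b.idx) := by
  ext k l
  simp [Block.sub, Matrix.diagonal_apply, b.idx_injective.eq_iff]

theorem Block.diagonal_mul_U (b : Block n) (ε : Fin n → ℝ) :
    Matrix.diagonal ε * b.U = b.U * b.sub (Matrix.diagonal ε) := by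
  ext i j
  rw [b.sub_diagonal, Matrix.diagonal_mul, Matrix.mul_diagonal]
  simp only [Block.U, Matrix.of_apply, Function.comp]
  split_ifs with h1
  · simp [h1]
  · simp

theorem Block.sub_one (b : Block n) : b.sub 1 = 1 := by
  ext k l
  simp [Block.sub, Matrix.one_apply, b.idx_injective.eq_iff]

/-- The block update preserves J-orthogonality. -/
theorem JOrth_step {J : Mat n} {ε : Fin n → ℝ} (hJ : J = Matrix.diagonal ε) {X : Mat n}
    (hX : X ∈ JOrth J) (b : Block n) {V : Mat 2} (hV : V ∈ JOrth (b.sub J)) :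
    X + b.U * (V - 1) * b.Uᵀ * X ∈ JOrth J := by
  simp only [JOrth, Set.mem_ofPred_eq] at hX hV ⊢
  -- `J` is diagonal, so it maps the span of the block coordinates to itself; this reduces the `n ×
  -- n` constraint to the `2 × 2` one.
  have h1 : J * b.U = b.U * b.sub J := by rw [hJ]; exact b.diagonal_mul_U ε
  have h2 : b.Uᵀ * J = b.sub J * b.Uᵀ := by
    have := congrArg Matrix.transpose h1
    have hs : (b.sub J)ᵀ = b.sub J := by
      rw [hJ, Block.sub, Matrix.transpose_submatrix, Matrix.diagonal_transpose]
    have hs' : Jᵀ = J := by rw [hJ, Matrix.diagonal_transpose]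
    rwa [Matrix.transpose_mul, Matrix.transpose_mul, hs, hs'] at this
  have h3 : b.Uᵀ * b.U = 1 := by
    have := b.transpose_U_mul_mul_U 1
    rwa [Matrix.mul_one, Block.sub_one] at this
  set K := b.sub J
  set U := b.U
  set W := V - 1 with hW
  have hVW : V = 1 + W := by rw [hW]; abel
  have hK : K * W + Wᵀ * K + Wᵀ * K * W = 0 := by
    rw [hVW] at hV
    simp only [Matrix.transpose_add, Matrix.transpose_one, Matrix.add_mul, Matrix.mul_add,
      Matrix.one_mul, Matrix.mul_one] at hV
    have : K * W + Wᵀ * K + Wᵀ * K * W = (K + Wᵀ * K + (K * W + Wᵀ * K * W)) - K := by abel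
    rw [this, hV, sub_self]
  have key : (1 + U * W * Uᵀ)ᵀ * J * (1 + U * W * Uᵀ) = J := by
    have e : (1 + U * W * Uᵀ)ᵀ * J * (1 + U * W * Uᵀ)
        = J + U * (K * W + Wᵀ * K + Wᵀ * K * W) * Uᵀ := by
      have a1 : J * (U * W * Uᵀ) = U * (K * W) * Uᵀ := by
        rw [← Matrix.mul_assoc, ← Matrix.mul_assoc, h1]; simp only [Matrix.mul_assoc]
      have a2 : (U * W * Uᵀ)ᵀ * J = U * (Wᵀ * K) * Uᵀ := by
        simp only [Matrix.transpose_mul, Matrix.transpose_transpose, Matrix.mul_assoc, h2]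
      have a3 : (U * W * Uᵀ)ᵀ * J * (U * W * Uᵀ) = U * (Wᵀ * K * W) * Uᵀ := by
        rw [a2]
        calc _ = U * (Wᵀ * K) * (Uᵀ * U) * W * Uᵀ := by simp only [Matrix.mul_assoc]
          _ = _ := by rw [h3]; simp only [Matrix.mul_assoc, Matrix.mul_one]
      rw [Matrix.transpose_add, Matrix.transpose_one, Matrix.add_mul, Matrix.add_mul,
        Matrix.mul_add, Matrix.mul_add, a3, a2, Matrix.one_mul, a1]
      simp only [Matrix.mul_add, Matrix.add_mul, Matrix.mul_one]
      abel
    rw [e, hK]; simp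
  have hX' : X + U * W * Uᵀ * X = (1 + U * W * Uᵀ) * X := by rw [Matrix.add_mul, Matrix.one_mul]
  rw [hX', Matrix.transpose_mul]
  calc _ = Xᵀ * ((1 + U * W * Uᵀ)ᵀ * J * (1 + U * W * Uᵀ)) * X := by simp only [Matrix.mul_assoc]
    _ = J := by rw [key, hX]

/-- By `vec (U C Z) = (Zᵀ ⊗ U) vec C`, the small form is `H` evaluated at the displacement that the
block step causes in `X`. -/
theorem vec_dotProduct_Qlow_mulVec (H : Matrix (Fin n × Fin n) (Fin n × Fin n) ℝ) (X : Mat n)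
    (b : Block n) (A B : Mat 2) : A.vec ⬝ᵥ (Qlow H X b *ᵥ B.vec)
      = (b.U * A * (b.Uᵀ * X)).vec ⬝ᵥ (H *ᵥ (b.U * B * (b.Uᵀ * X)).vec) := by
  have h (C : Mat 2) : ((b.Uᵀ * X)ᵀ ⊗ₖ b.U) *ᵥ C.vec = (b.U * C * (b.Uᵀ * X)).vec := by
    have := Matrix.kronecker_mulVec_vec b.U C (b.Uᵀ * X)ᵀ
    rwa [Matrix.transpose_transpose] at this
  rw [Qlow, ← Matrix.mulVec_mulVec, h, ← Matrix.mulVec_mulVec, Matrix.dotProduct_mulVec,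
    Matrix.vecMul_transpose, h]

theorem quadForm_Qlow (H : Matrix (Fin n × Fin n) (Fin n × Fin n) ℝ) (X : Mat n)
    (b : Block n) (W : Mat 2) :
    quadForm (Qlow H X b) W = quadForm H (b.U * W * (b.Uᵀ * X)) :=
  vec_dotProduct_Qlow_mulVec H X b W W

theorem vec_dotProduct_smul_one_mulVec (s : ℝ) (A B : Mat n) :
    A.vec ⬝ᵥ ((s • (1 : Matrix (Fin n × Fin n) (Fin n × Fin n) ℝ)) *ᵥ B.vec)
      = s * (A.vec ⬝ᵥ B.vec) := by
  rw [Matrix.smul_mulVec, Matrix.one_mulVec, dotProduct_smul, smul_eq_mul]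

theorem quadForm_smul_one (s : ℝ) (A : Mat n) :
    quadForm (s • (1 : Matrix (Fin n × Fin n) (Fin n × Fin n) ℝ)) A = s * ‖A‖ ^ 2 := by
  rw [quadForm, vec_dotProduct_smul_one_mulVec, vec_dotProduct_self]

theorem quadForm_add (M N : Matrix (Fin n × Fin n) (Fin n × Fin n) ℝ) (A : Mat n) :
    quadForm (M + N) A = quadForm M A + quadForm N A := by
  rw [quadForm, Matrix.add_mulVec, dotProduct_add]; rfl

theorem quadForm_Qlow_le {H : Matrix (Fin n × Fin n) (Fin n × Fin n) ℝ} {L : ℝ} {X : Mat n}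
    {b : Block n} {Q : Matrix (Fin 2 × Fin 2) (Fin 2 × Fin 2) ℝ} (hQ : AdmissibleQ H L X b Q)
    (W : Mat 2) : quadForm (Qlow H X b) W ≤ quadForm Q W := by
  rcases hQ with rfl | ⟨s, hs, -, rfl⟩
  · exact le_rfl
  · rw [quadForm_smul_one]
    have h := (le_abs_self _).trans (abs_vec_dotProduct_mulVec_le (Qlow H X b) W W)
    have h2 : specNorm (Qlow H X b) * ‖W‖ * ‖W‖ ≤ s * ‖W‖ ^ 2 := by
      rw [mul_assoc, ← pow_two]; gcongr
    exact h.trans h2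

theorem frobInner_block (b : Block n) (W : Mat 2) (X G : Mat n) :
    frobInner (b.U * W * (b.Uᵀ * X)) G = frobInner W (b.sub (G * Xᵀ)) := by
  rw [frobInner, frobInner, ← b.transpose_U_mul_mul_U]
  simp only [Matrix.transpose_mul, Matrix.transpose_transpose, Matrix.mul_assoc]
  rw [Matrix.trace_mul_comm]
  simp only [Matrix.mul_assoc]
  rw [Matrix.trace_mul_comm]
  simp only [Matrix.mul_assoc]

/-- Sufficient decrease of the objective in one block update. -/
theorem descent {J : Mat n} {f : Mat n → ℝ} {H : Matrix (Fin n × Fin n) (Fin n × Fin n) ℝ}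
    {L θ : ℝ} (hupper : ∀ X Y : Mat n, f Y ≤ f X + frobInner (Y - X) (matGrad f X)
      + (1 / 2) * quadForm H (Y - X)) {X : Mat n} {b : Block n}
    {Q : Matrix (Fin 2 × Fin 2) (Fin 2 × Fin 2) ℝ} (hQ : AdmissibleQ H L X b Q) {V : Mat 2}
    (hmin : IsMinOn (majorizer f θ Q X b) (JOrth (b.sub J)) V) :
    f (X + b.U * (V - 1) * b.Uᵀ * X) + θ / 2 * ‖V - 1‖ ^ 2 ≤ f X := by
  -- The identity is feasible with majorizer value `f X`. The upper bound on `f` uses up the `Q`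
  -- part of the quadratic term; the `θ` part remains as decrease.
  have h1 : (1 : Mat 2) ∈ JOrth (b.sub J) := by simp [JOrth]
  have h2 : majorizer f θ Q X b V ≤ majorizer f θ Q X b 1 := hmin h1
  have h3 := hupper X (X + b.U * (V - 1) * b.Uᵀ * X)
  rw [add_sub_cancel_left, Matrix.mul_assoc _ b.Uᵀ X, frobInner_block, ← quadForm_Qlow] at h3
  have h4 := quadForm_Qlow_le hQ (V - 1)
  rw [Matrix.mul_assoc _ b.Uᵀ X]
  have h5 : majorizer f θ Q X b 1 = f X := by
    simp [majorizer, quadForm, frobInner]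
  rw [h5, majorizer, quadForm_add, quadForm_smul_one] at h2
  linarith

end Blocks

/-! ### First-order optimality in the `2 × 2` subproblem -/

section Optimality

/-- First-order optimality in the direction `Ξ V` of a minimizer `V` of a quadratic function over the
J-orthogonal `2 × 2` matrices, where `Ξ` spans the Lie algebra. -/
theorem isMinOn_JOrth_two_stationary (k : Fin 2 → ℝ) (hk : ∀ i, k i = 1 ∨ k i = -1)
    (P : Matrix (Fin 2 × Fin 2) (Fin 2 × Fin 2) ℝ) (A V : Mat 2)
    (hV : V ∈ JOrth (Matrix.diagonal k))
    (hmin : IsMinOn (fun W => (1 / 2) * quadForm P (W - 1) + frobInner (W - 1) A)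
      (JOrth (Matrix.diagonal k)) V) :
    frobInner (!![0, k 0; -k 1, 0] * V) A
      + (1 / 2) * ((V - 1).vec ⬝ᵥ (P *ᵥ (!![0, k 0; -k 1, 0] * V).vec)
        + (!![0, k 0; -k 1, 0] * V).vec ⬝ᵥ (P *ᵥ (V - 1).vec)) = 0 := by
  set Ξ : Mat 2 := !![0, k 0; -k 1, 0] with hΞ
  set κ : ℝ := k 0 * k 1 with hκ
  -- Since `Ξ² = -κ I`, the Cayley transform `(I - sΞ)⁻¹ (I + sΞ)` equals `I + u(s) (Ξ - κ s I)`.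
  -- This rational curve treats rotations (`κ = 1`) and hyperbolic rotations (`κ = -1`) at once; its
  -- velocity at `0` is `2Ξ`.
  let u : ℝ → ℝ := fun s => 2 * s / (1 + κ * s ^ 2)
  let D : ℝ → Mat 2 := fun s => (Ξ * V) - (κ * s) • V
  have hmem : ∀ s : ℝ, 1 + κ * s ^ 2 ≠ 0 → V + u s • D s ∈ JOrth (Matrix.diagonal k) := by
    intro s hs
    have hu : u s * (1 + κ * s ^ 2) = 2 * s := div_mul_cancel₀ _ hs
    have e : V + u s • D s = (1 + u s • (Ξ - (κ * s) • (1 : Mat 2))) * V := by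
      simp only [D, Matrix.add_mul, Matrix.one_mul, Matrix.smul_mul, Matrix.sub_mul]
    have hR : (1 + u s • (Ξ - (κ * s) • (1 : Mat 2)))ᵀ * Matrix.diagonal k
        * (1 + u s • (Ξ - (κ * s) • (1 : Mat 2))) = Matrix.diagonal k := by
      generalize u s = w at hu
      ext i j
      rcases hk 0 with h0 | h0 <;> rcases hk 1 with h1 | h1 <;> simp only [hκ, h0, h1] at hu <;>
        fin_cases i <;> fin_cases j <;>
        simp [Matrix.mul_apply, Fin.sum_univ_two, hΞ, hκ, h0, h1, Matrix.one_apply] <;>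
        first
        | ring1
        | linear_combination w * hu
        | linear_combination -w * hu
    simp only [JOrth, Set.mem_ofPred_eq] at hV ⊢
    rw [e, Matrix.transpose_mul]
    calc _ = Vᵀ * ((1 + u s • (Ξ - (κ * s) • (1 : Mat 2)))ᵀ * Matrix.diagonal k
        * (1 + u s • (Ξ - (κ * s) • (1 : Mat 2)))) * V := by simp only [Matrix.mul_assoc]
      _ = _ := by rw [hR, hV]
  set b : Mat 2 → Mat 2 → ℝ := fun C D => C.vec ⬝ᵥ (P *ᵥ D.vec) with hb
  have hbal : ∀ (x y : ℝ) (C E F : Mat 2), b (x • C + y • E) F = x * b C F + y * b E F := by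
    intro x y C E F
    simp [hb, Matrix.vec_add, Matrix.vec_smul, add_dotProduct]
  have hbar : ∀ (x y : ℝ) (C E F : Mat 2), b F (x • C + y • E) = x * b F C + y * b F E := by
    intro x y C E F
    simp [hb, Matrix.vec_add, Matrix.vec_smul, Matrix.mulVec_add, Matrix.mulVec_smul]
  have hfi : ∀ (x y : ℝ) (C E : Mat 2),
      frobInner (x • C + y • E) A = x * frobInner C A + y * frobInner E A := by
    intro x y C E
    simp [frobInner, Matrix.add_mul]
  have hq : ∀ W, quadForm P W = b W W := fun W => rfl
  set α := frobInner (Ξ * V) A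
      + (1 / 2) * ((V - 1).vec ⬝ᵥ (P *ᵥ (Ξ * V).vec) + (Ξ * V).vec ⬝ᵥ (P *ᵥ (V - 1).vec)) with hα
  set β := frobInner V A + (1 / 2) * (b (V - 1) V + b V (V - 1)) with hβ
  have hexp : ∀ s, (1 / 2) * quadForm P (V + u s • D s - 1) + frobInner (V + u s • D s - 1) A
      = ((1 / 2) * quadForm P (V - 1) + frobInner (V - 1) A) + u s * (α - κ * s * β)
        + (1 / 2) * u s ^ 2 * (b (Ξ * V) (Ξ * V) - κ * s * (b (Ξ * V) V + b V (Ξ * V))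
          + (κ * s) ^ 2 * b V V) := by
    intro s
    have e : V + u s • D s - 1
        = (1 : ℝ) • (V - 1) + u s • ((1 : ℝ) • (Ξ * V) + (-(κ * s)) • V) := by
      simp only [D]; rw [one_smul, one_smul, neg_smul, sub_eq_add_neg (Ξ * V)]; abel
    have hα' : α = frobInner (Ξ * V) A + (1 / 2) * (b (V - 1) (Ξ * V) + b (Ξ * V) (V - 1)) := rfl
    rw [e, hfi, hfi, hq, hq]
    simp only [hbal, hbar]
    rw [hα', hβ]
    ring
  let φ : ℝ → ℝ := fun s => u s * (α - κ * s * β)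
        + (1 / 2) * u s ^ 2 * (b (Ξ * V) (Ξ * V) - κ * s * (b (Ξ * V) V + b V (Ξ * V))
          + (κ * s) ^ 2 * b V V)
  have hloc : IsLocalMin φ 0 := by
    have hc : ∀ᶠ s : ℝ in 𝓝 0, 1 + κ * s ^ 2 ≠ 0 := by
      have : ContinuousAt (fun s : ℝ => 1 + κ * s ^ 2) 0 := by fun_prop
      exact this.eventually_ne (by simp)
    filter_upwards [hc] with s hs
    have h : (1 / 2) * quadForm P (V - 1) + frobInner (V - 1) A ≤ (1 / 2) * quadForm P (V + u s • D s - 1)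
        + frobInner (V + u s • D s - 1) A := hmin (hmem s hs)
    rw [hexp s] at h
    have h0 : φ 0 = 0 := by simp [φ, u]
    rw [h0]
    simp only [φ]
    linarith
  have hu : HasDerivAt u 2 0 := by
    have h1 : HasDerivAt (fun s : ℝ => 2 * s) 2 0 := by
      simpa using (hasDerivAt_id (0 : ℝ)).const_mul 2
    have h2 : HasDerivAt (fun s : ℝ => 1 + κ * s ^ 2) (κ * (2 * 0)) 0 := by
      simpa using ((hasDerivAt_pow 2 (0 : ℝ)).const_mul κ).const_add 1
    exact (h1.div h2 (by simp)).congr_deriv (by simp)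
  have hφ : HasDerivAt φ (2 * α) 0 := by
    have h1 : HasDerivAt (fun s : ℝ => α - κ * s * β) (-(κ * 1 * β)) 0 := by
      exact (((hasDerivAt_id (0 : ℝ)).const_mul κ).mul_const β).const_sub α
    have h3 : DifferentiableAt ℝ (fun s : ℝ => b (Ξ * V) (Ξ * V)
        - κ * s * (b (Ξ * V) V + b V (Ξ * V)) + (κ * s) ^ 2 * b V V) 0 := by fun_prop
    exact ((hu.mul h1).add (((hu.pow 2).const_mul (1 / 2)).mul h3.hasDerivAt)).congr_deriv
      (by simp [u])
  have := hloc.hasDerivAt_eq_zero hφ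
  linarith

/-- Write `Ξ V = Ξ + Ξ (V - I)` in the stationarity equation: `⟨Ξ, A⟩` is the skew entry, and every
other term carries a factor `V - I`. -/
theorem abs_skew_le_of_isMinOn (k : Fin 2 → ℝ) (hk : ∀ i, k i = 1 ∨ k i = -1)
    (P : Matrix (Fin 2 × Fin 2) (Fin 2 × Fin 2) ℝ) {q : ℝ}
    (hP : ∀ C D : Mat 2, |C.vec ⬝ᵥ (P *ᵥ D.vec)| ≤ q * ‖C‖ * ‖D‖) (A V : Mat 2)
    (hV : V ∈ JOrth (Matrix.diagonal k))
    (hmin : IsMinOn (fun W => (1 / 2) * quadForm P (W - 1) + frobInner (W - 1) A)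
      (JOrth (Matrix.diagonal k)) V) :
    |k 0 * A 0 1 - k 1 * A 1 0| ≤ 2 * (‖A‖ + q * (‖V - 1‖ + 2)) * ‖V - 1‖ := by
  have h := isMinOn_JOrth_two_stationary k hk P A V hV hmin
  set Ξ : Mat 2 := !![0, k 0; -k 1, 0] with hΞ
  have hk1 : ∀ i, |k i| ≤ 1 := fun i => by rcases hk i with h | h <;> simp [h]
  have hΞn : ‖Ξ‖ ≤ 2 := by
    have := norm_le_of_abs_entry_le Ξ (c := 1) (by
      intro i j
      fin_cases i <;> fin_cases j <;> simp [hΞ, hk1])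
    simpa using this
  have h1n : ‖(1 : Mat 2)‖ ≤ 2 := by
    have := norm_le_of_abs_entry_le (1 : Mat 2) (c := 1) (by
      intro i j
      fin_cases i <;> fin_cases j <;> simp)
    simpa using this
  have hVn : ‖V‖ ≤ ‖V - 1‖ + 2 := by
    have := norm_add_le (V - 1) 1
    rw [sub_add_cancel] at this
    linarith
  have hq : 0 ≤ q := by
    have h1 := (abs_nonneg _).trans (hP 1 1)
    have h2 : 0 < ‖(1 : Mat 2)‖ := norm_pos_iff.2 one_ne_zero
    by_contra hq
    nlinarith [mul_pos h2 h2]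
  have hΞV : ‖Ξ * V‖ ≤ 2 * (‖V - 1‖ + 2) := by
    refine (Matrix.frobenius_norm_mul _ _).trans ?_
    gcongr
  have e1 : frobInner (Ξ * V) A = (k 0 * A 0 1 - k 1 * A 1 0) + frobInner (Ξ * (V - 1)) A := by
    have : frobInner Ξ A = k 0 * A 0 1 - k 1 * A 1 0 := by
      simp [frobInner, Matrix.trace, Matrix.mul_apply, Fin.sum_univ_two, hΞ]
      ring
    rw [← this, Matrix.mul_sub, Matrix.mul_one]
    simp [frobInner, Matrix.sub_mul]
  have b1 : |frobInner (Ξ * (V - 1)) A| ≤ 2 * ‖V - 1‖ * ‖A‖ := by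
    refine (abs_frobInner_le _ _).trans ?_
    gcongr
    exact (Matrix.frobenius_norm_mul _ _).trans (by gcongr)
  have b2 : |(V - 1).vec ⬝ᵥ (P *ᵥ (Ξ * V).vec)| ≤ q * ‖V - 1‖ * (2 * (‖V - 1‖ + 2)) :=
    (hP _ _).trans (by gcongr)
  have b3 : |(Ξ * V).vec ⬝ᵥ (P *ᵥ (V - 1).vec)| ≤ q * (2 * (‖V - 1‖ + 2)) * ‖V - 1‖ :=
    (hP _ _).trans (by gcongr)
  rw [e1] at h
  rw [abs_le] at *
  constructor <;> linarith [b1.1, b1.2, b2.1, b2.2, b3.1, b3.2]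

end Optimality

/-! ### Subgradients of `f` plus the indicator -/

section Subdifferential

variable {n : ℕ}

theorem fderiv_apply_eq_frobInner (f : Mat n → ℝ) (X W : Mat n) :
    fderiv ℝ f X W = frobInner (matGrad f X) W := by
  conv_lhs => rw [Matrix.matrix_eq_sum_single W]
  simp only [map_sum]
  rw [frobInner, Matrix.trace, Finset.sum_comm]
  simp only [Matrix.diag_apply, Matrix.mul_apply, Matrix.transpose_apply, matGrad, Matrix.of_apply]
  refine Finset.sum_congr rfl fun j _ => Finset.sum_congr rfl fun i _ => ?_
  have : Matrix.single i j (W i j) = W i j • Matrix.single i j (1 : ℝ) := by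
    rw [Matrix.smul_single, smul_eq_mul, mul_one]
  rw [this, map_smul, smul_eq_mul, mul_comm]

theorem addIndicator_of_mem (f : Mat n → ℝ) {C : Set (Mat n)} {X : Mat n} (hX : X ∈ C) :
    addIndicator f C X = (f X : EReal) := by
  simp [addIndicator, hX]

theorem addIndicator_of_notMem (f : Mat n → ℝ) {C : Set (Mat n)} {X : Mat n} (hX : X ∉ C) :
    addIndicator f C X = ⊤ := by
  simp [addIndicator, hX]

theorem frechetSubdiff_subset_limitingSubdiff (F : Mat n → EReal) (X : Mat n) :
    frechetSubdiff F X ⊆ limitingSubdiff F X := fun G hG =>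
  ⟨hG.1, hG.2.1, fun _ => X, fun _ => G, tendsto_const_nhds, tendsto_const_nhds, fun _ => hG,
    tendsto_const_nhds⟩

/-- The matrices `J X S` with `S` symmetric are normal to the J-orthogonal matrices at `X`. -/
theorem frobInner_normal {J X Y S : Mat n} (hJ : Jᵀ = J) (hS : Sᵀ = S) (hX : X ∈ JOrth J)
    (hY : Y ∈ JOrth J) :
    2 * frobInner (J * X * S) (Y - X) = - frobInner S ((Y - X)ᵀ * J * (Y - X)) := by
  simp only [JOrth, Set.mem_ofPred_eq] at hX hY
  have h1 : (Y - X)ᵀ * J * (Y - X) = - (Xᵀ * J * (Y - X)) - (Xᵀ * J * (Y - X))ᵀ := by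
    simp only [Matrix.transpose_mul, Matrix.transpose_transpose, Matrix.transpose_sub, hJ,
      Matrix.sub_mul, Matrix.mul_sub, ← Matrix.mul_assoc, hX, hY]
    abel
  have h2 : frobInner (J * X * S) (Y - X) = frobInner S (Xᵀ * J * (Y - X)) := by
    simp only [frobInner, Matrix.transpose_mul, hS, hJ, Matrix.mul_assoc]
  have h3 : frobInner S (Xᵀ * J * (Y - X))ᵀ = frobInner S (Xᵀ * J * (Y - X)) := by
    rw [frobInner, ← Matrix.transpose_mul, Matrix.trace_transpose, Matrix.trace_mul_comm, frobInner,
      hS]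
  have h4 : ∀ C D : Mat n, frobInner S (-C - D) = -frobInner S C - frobInner S D := by
    intro C D
    simp [frobInner, Matrix.mul_sub]
  rw [h1, h4, h3, h2]
  ring

/-- Pairing a normal `J X S` with a feasible displacement `Y - X` is of second order by
`frobInner_normal`, so it costs `ε/2`, as does the linearization of `f`. Infeasible `Y` impose
nothing. -/
theorem matGrad_sub_mem_frechetSubdiff {f : Mat n → ℝ} {J X S : Mat n}
    (hf : DifferentiableAt ℝ f X) (hJ : Jᵀ = J) (hS : Sᵀ = S) (hX : X ∈ JOrth J) :
    matGrad f X - J * X * S ∈ frechetSubdiff (addIndicator f (JOrth J)) X := by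
  refine ⟨by simp [addIndicator_of_mem f hX], by simp [addIndicator_of_mem f hX], fun ε hε => ?_⟩
  rw [addIndicator_of_mem f hX, EReal.toReal_coe]
  have h1 : ∀ᶠ Y in 𝓝 X, ‖f Y - f X - fderiv ℝ f X (Y - X)‖ ≤ ε / 2 * ‖Y - X‖ :=
    hf.hasFDerivAt.isLittleO.def (half_pos hε)
  have h2 : ∀ᶠ Y in 𝓝 X, ‖S‖ * ‖J‖ * ‖Y - X‖ < ε := by
    have : Tendsto (fun Y : Mat n => ‖S‖ * ‖J‖ * ‖Y - X‖) (𝓝 X) (𝓝 (‖S‖ * ‖J‖ * ‖X - X‖)) :=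
      Continuous.tendsto (by fun_prop) X
    exact this.eventually_lt_const (by simpa using hε)
  filter_upwards [h1, h2] with Y hY1 hY2
  by_cases hY : Y ∈ JOrth J
  · rw [addIndicator_of_mem f hY, EReal.coe_le_coe_iff]
    rw [fderiv_apply_eq_frobInner, Real.norm_eq_abs] at hY1
    have h3 := frobInner_normal hJ hS hX hY
    have h4 : |frobInner S ((Y - X)ᵀ * J * (Y - X))| ≤ ε * ‖Y - X‖ := by
      calc _ ≤ ‖S‖ * (‖Y - X‖ * ‖J‖ * ‖Y - X‖) := by
            refine (abs_frobInner_le _ _).trans ?_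
            gcongr
            refine (Matrix.frobenius_norm_mul _ _).trans ?_
            gcongr
            refine (Matrix.frobenius_norm_mul _ _).trans ?_
            rw [Matrix.frobenius_norm_transpose]
        _ = (‖S‖ * ‖J‖ * ‖Y - X‖) * ‖Y - X‖ := by ring
        _ ≤ _ := by gcongr
    have h5 : frobInner (matGrad f X - J * X * S) (Y - X)
        = frobInner (matGrad f X) (Y - X) - frobInner (J * X * S) (Y - X) := by
      simp only [frobInner, Matrix.transpose_sub, Matrix.sub_mul, Matrix.trace_sub]
    rw [h5]
    have := (abs_le.1 hY1).1
    have := (abs_le.1 h4).2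
    linarith
  · rw [addIndicator_of_notMem f hY]; exact le_top

/-- The distance of `0` to the limiting subdifferential of `f + I_𝒥` is controlled by the skew part
of `J ∇f(X) Xᵀ`. -/
theorem infDist_limitingSubdiff_le {f : Mat n → ℝ} {J X : Mat n} {ε : Fin n → ℝ}
    (hε : ∀ i, ε i = 1 ∨ ε i = -1) (hJ : J = Matrix.diagonal ε) (hf : DifferentiableAt ℝ f X)
    (hX : X ∈ JOrth J) {δ : ℝ}
    (hδ : ∀ i j, |ε i * (matGrad f X * Xᵀ) i j - ε j * (matGrad f X * Xᵀ) j i| ≤ δ) :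
    Metric.infDist 0 (limitingSubdiff (addIndicator f (JOrth J)) X)
      ≤ n * δ * (n * ‖X‖ * n) := by
  set G := matGrad f X
  set A := G * Xᵀ with hA
  have hJT : Jᵀ = J := by rw [hJ, Matrix.diagonal_transpose]
  have hJJ : J * J = 1 := by
    rw [hJ, Matrix.diagonal_mul_diagonal, ← Matrix.diagonal_one]
    congr 1; ext i; rcases hε i with h | h <;> simp [h]
  have hX' : Xᵀ * J * X = J := hX
  have hX1 : Xᵀ * (J * X * J) = 1 := by
    rw [← Matrix.mul_assoc, ← Matrix.mul_assoc, hX', hJJ]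
  have hX2 : (J * X * J) * Xᵀ = 1 := mul_eq_one_comm.1 hX1
  set R : Mat n := (1 / 2 : ℝ) • (J * A + Aᵀ * J) with hR
  have hRT : Rᵀ = R := by
    have h : (J * A)ᵀ = Aᵀ * J := by rw [Matrix.transpose_mul, hJT]
    rw [hR, Matrix.transpose_smul, Matrix.transpose_add, ← h, Matrix.transpose_transpose, add_comm]
  -- Feasibility gives `X⁻¹ = J Xᵀ J` and `X⁻ᵀ = J X J`. With `R` the symmetric part of `J A`, this
  -- `S` makes `J X S = J R X⁻ᵀ`, while `G = A X⁻ᵀ`; so `G - J X S` is `J` times the skew part of `J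
  -- A`, times `X⁻ᵀ`.
  set S : Mat n := (J * Xᵀ * J) * R * (J * X * J) with hS
  have hST : Sᵀ = S := by
    simp only [hS, Matrix.transpose_mul, Matrix.transpose_transpose, hJT, hRT, Matrix.mul_assoc]
  have hJS : J * X * S = J * R * (J * X * J) := by
    calc J * X * S = (J * X * J) * Xᵀ * (J * R * (J * X * J)) := by
          simp only [hS, Matrix.mul_assoc]
      _ = _ := by rw [hX2, Matrix.one_mul]
  have hG : G = A * (J * X * J) := by rw [hA, Matrix.mul_assoc, hX1, Matrix.mul_one]
  have hdiff : G - J * X * S = (A - J * R) * (J * X * J) := by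
    rw [hJS, Matrix.sub_mul, ← hG]
  have hmem := frechetSubdiff_subset_limitingSubdiff _ _
    (matGrad_sub_mem_frechetSubdiff hf hJT hST hX)
  refine (Metric.infDist_le_dist_of_mem hmem).trans ?_
  rw [dist_zero_left]
  change ‖G - J * X * S‖ ≤ _
  rw [hdiff]
  have hJn : ‖J‖ ≤ n := by
    have := norm_le_of_abs_entry_le J (c := 1) (by
      intro i j
      rw [hJ, Matrix.diagonal_apply]
      split_ifs
      · rcases hε i with h | h <;> simp [h]
      · simp)
    simpa using this
  refine (Matrix.frobenius_norm_mul _ _).trans ?_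
  have hδ0 : 0 ≤ (n : ℝ) * δ := by
    rcases Nat.eq_zero_or_pos n with h | h
    · simp [h]
    · have := (abs_nonneg _).trans (hδ ⟨0, h⟩ ⟨0, h⟩)
      positivity
  gcongr
  · refine norm_le_of_abs_entry_le _ fun i j => ?_
    have e : (A - J * R) i j = (1 / 2) * ε i * (ε i * A i j - ε j * A j i) := by
      have hi : ε i * ε i = 1 := by rcases hε i with h | h <;> simp [h]
      rw [Matrix.sub_apply, hR, Matrix.mul_smul, Matrix.smul_apply, Matrix.mul_add,
        ← Matrix.mul_assoc, hJJ, Matrix.one_mul, Matrix.add_apply, hJ, Matrix.diagonal_mul,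
        Matrix.mul_diagonal, Matrix.transpose_apply, smul_eq_mul]
      linear_combination (-1 / 2 * A i j) * hi
    have hi : |ε i| = 1 := by rcases hε i with h | h <;> simp [h]
    rw [e, abs_mul, abs_mul, hi]
    have := hδ i j
    have := abs_nonneg (ε i * A i j - ε j * A j i)
    norm_num
    linarith
  · refine (Matrix.frobenius_norm_mul _ _).trans ?_
    gcongr
    exact (Matrix.frobenius_norm_mul _ _).trans (by gcongr)

end Subdifferential

/-! ### Rates for sequences that decrease at a positive fraction of times -/

section Rates

theorem sum_indicator_Ico_le {G : Set ℕ} (T : ℕ) :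
    ∑ s ∈ Finset.range T, G.indicator (1 : ℕ → ℝ) s ≤ T := by
  have : ∀ s ∈ Finset.range T, G.indicator (1 : ℕ → ℝ) s ≤ 1 := fun s _ =>
    Set.indicator_le_self' (fun _ _ => zero_le_one) s
  simpa using Finset.sum_le_card_nsmul _ _ _ this

/-- The discrete counterpart of solving `x' = -a x^(1+r)`: in the variable `x^(-r)` each decrease
adds at least `r a`. It rests on Bernoulli's inequality for exponents at most `1` and on `(1 - rz)(1
+ rz) ≤ 1`. -/
theorem rpow_neg_add_le {x y a r : ℝ} (hy : 0 < y) (hyx : 0 < x) (hr : 0 < r) (hr1 : r ≤ 1)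
    (ha : 0 < a) (h : y ≤ x - a * x ^ (1 + r)) : x ^ (-r) + r * a ≤ y ^ (-r) := by
  have hxr : 0 < x ^ r := Real.rpow_pos_of_pos hyx r
  have hyr : 0 < y ^ r := Real.rpow_pos_of_pos hy r
  set z := a * x ^ r with hz
  have hz0 : 0 < z := mul_pos ha hxr
  have h1 : y ≤ x * (1 - z) := by
    rw [Real.rpow_add hyx, Real.rpow_one] at h
    rw [hz]; linarith
  have hz1 : 0 < 1 - z := by
    by_contra hcon
    have := mul_nonpos_of_nonneg_of_nonpos hyx.le (not_lt.1 hcon)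
    linarith
  have h2 : y ^ r ≤ x ^ r * (1 - r * z) := by
    calc y ^ r ≤ (x * (1 - z)) ^ r := Real.rpow_le_rpow hy.le h1 hr.le
      _ = x ^ r * (1 + -z) ^ r := by rw [Real.mul_rpow hyx.le hz1.le, sub_eq_add_neg]
      _ ≤ x ^ r * (1 + r * -z) := by
        gcongr
        exact rpow_one_add_le_one_add_mul_self (by linarith) hr.le hr1
      _ = _ := by ring
  rw [Real.rpow_neg hyx.le, Real.rpow_neg hy.le, le_inv_comm₀ (by positivity) hyr]
  have h3 : (x ^ r)⁻¹ + r * a = (1 + r * z) / x ^ r := by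
    rw [hz]; field_simp
  rw [h3, inv_div, le_div_iff₀ (by positivity)]
  calc y ^ r * (1 + r * z) ≤ x ^ r * (1 - r * z) * (1 + r * z) := by gcongr
    _ = x ^ r * (1 - (r * z) ^ 2) := by ring
    _ ≤ x ^ r * 1 := by gcongr; nlinarith [sq_nonneg (r * z)]
    _ = x ^ r := mul_one _

/-- A sequence with superlinear relative decrease at a positive fraction of the times decays
polynomially. -/
theorem eventually_le_rpow_of_decrease {Δ : ℕ → ℝ} (h0 : ∀ t, 0 ≤ Δ t) (hanti : Antitone Δ)
    {G : Set ℕ} {q : ℝ} (hq : 0 < q)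
    (hcount : ∀ᶠ t : ℕ in atTop, q * t ≤ ∑ s ∈ Finset.range t, G.indicator (1 : ℕ → ℝ) s)
    {r a : ℝ} (hr : 0 < r) (hr1 : r ≤ 1) (ha : 0 < a) {T : ℕ}
    (hgood : ∀ t ≥ T, t ∈ G → Δ (t + 1) ≤ Δ t - a * Δ t ^ (1 + r)) :
    ∃ C : ℝ, 0 < C ∧ ∀ᶠ t : ℕ in atTop, Δ t ≤ C * (t : ℝ) ^ (-(1 / r)) := by
  set c : ℕ → ℝ := fun t => ∑ s ∈ Finset.range t, G.indicator (1 : ℕ → ℝ) s with hc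
  -- `c t - c T` counts the good times since `T`. Each adds `r a`; at the other times monotonicity
  -- suffices.
  have claim : ∀ t ≥ T, 0 < Δ t → r * a * (c t - c T) ≤ Δ t ^ (-r) := by
    intro t ht
    induction t, ht using Nat.le_induction with
    | base => intro h; rw [sub_self, mul_zero]; positivity
    | succ t ht ih =>
      intro h
      have hpos : 0 < Δ t := h.trans_le (hanti t.le_succ)
      have ih := ih hpos
      have hcs : c (t + 1) = c t + G.indicator (1 : ℕ → ℝ) t := Finset.sum_range_succ _ _
      by_cases hG : t ∈ G
      · have := rpow_neg_add_le h hpos hr hr1 ha (hgood t ht hG)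
        rw [hcs, Set.indicator_of_mem hG, Pi.one_apply]
        linarith
      · rw [hcs, Set.indicator_of_notMem hG, add_zero]
        exact ih.trans (Real.rpow_le_rpow_of_nonpos h (hanti t.le_succ) (by linarith))
  refine ⟨(r * a * q / 2) ^ (-(1 / r)), by positivity, ?_⟩
  -- Half of the guaranteed count absorbs the at most `T` good times before `T`.
  have hlarge : ∀ᶠ t : ℕ in atTop, (T : ℝ) ≤ q / 2 * t :=
    (tendsto_natCast_atTop_atTop.const_mul_atTop (half_pos hq)).eventually_ge_atTop _
  filter_upwards [hcount, hlarge, eventually_ge_atTop T, eventually_gt_atTop 0]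
    with t h1 h2 h3 h4
  have ht : (0 : ℝ) < t := by exact_mod_cast h4
  rcases (h0 t).eq_or_lt with h | h
  · rw [← h]; positivity
  · have h5 := claim t h3 h
    have h6 : c T ≤ T := sum_indicator_Ico_le T
    have h7 : r * a * q / 2 * t ≤ Δ t ^ (-r) := by
      refine le_trans ?_ h5
      have : q / 2 * t ≤ c t - c T := by simp only [hc] at h6 ⊢; linarith
      calc r * a * q / 2 * t = r * a * (q / 2 * t) := by ring
        _ ≤ _ := by gcongr
    calc Δ t = (Δ t ^ (-r)) ^ (-(1 / r)) := by
          rw [← Real.rpow_mul h.le]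
          have : -r * -(1 / r) = 1 := by field_simp
          rw [this, Real.rpow_one]
      _ ≤ (r * a * q / 2 * t) ^ (-(1 / r)) :=
          Real.rpow_le_rpow_of_nonpos (by positivity) h7 (by
            rw [neg_nonpos]; positivity)
      _ = _ := Real.mul_rpow (by positivity) ht.le

/-- A sequence with linear relative decrease at a positive fraction of the times decays
geometrically. -/
theorem eventually_le_exp_of_decrease {Δ : ℕ → ℝ} (h0 : ∀ t, 0 ≤ Δ t) (hanti : Antitone Δ)
    {G : Set ℕ} {q : ℝ}
    (hcount : ∀ᶠ t : ℕ in atTop, q * t ≤ ∑ s ∈ Finset.range t, G.indicator (1 : ℕ → ℝ) s)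
    {a : ℝ} (ha : 0 < a) {T : ℕ} (hgood : ∀ t ≥ T, t ∈ G → Δ (t + 1) ≤ Δ t - a * Δ t) :
    ∃ C : ℝ, 0 < C ∧ ∀ᶠ t : ℕ in atTop, Δ t ≤ C * Real.exp (-(a * q) * t) := by
  set c : ℕ → ℝ := fun t => ∑ s ∈ Finset.range t, G.indicator (1 : ℕ → ℝ) s with hc
  have claim : ∀ t ≥ T, Δ t ≤ Δ T * Real.exp (-a * (c t - c T)) := by
    intro t ht
    induction t, ht using Nat.le_induction with
    | base => simp
    | succ t ht ih =>
      have hcs : c (t + 1) = c t + G.indicator (1 : ℕ → ℝ) t := Finset.sum_range_succ _ _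
      by_cases hG : t ∈ G
      · rw [hcs, Set.indicator_of_mem hG, Pi.one_apply]
        -- Passing through `1 - a ≤ exp (-a)` avoids having to assume `a ≤ 1`.
        calc Δ (t + 1) ≤ (-a + 1) * Δ t := by linarith [hgood t ht hG]
          _ ≤ Real.exp (-a) * Δ t := by gcongr; exacts [h0 t, Real.add_one_le_exp _]
          _ ≤ Real.exp (-a) * (Δ T * Real.exp (-a * (c t - c T))) := by gcongr
          _ = Δ T * Real.exp (-a + -a * (c t - c T)) := by rw [Real.exp_add]; ring
          _ = _ := by ring_nf
      · rw [hcs, Set.indicator_of_notMem hG, add_zero]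
        exact (hanti t.le_succ).trans ih
  refine ⟨(Δ T + 1) * Real.exp (a * T), by have := h0 T; positivity, ?_⟩
  filter_upwards [hcount, eventually_ge_atTop T] with t h1 h3
  have h6 : c T ≤ T := sum_indicator_Ico_le T
  calc Δ t ≤ Δ T * Real.exp (-a * (c t - c T)) := claim t h3
    _ ≤ (Δ T + 1) * Real.exp (a * T + -(a * q) * t) := by
      have := h0 T
      gcongr
      · linarith
      · have : q * t - T ≤ c t - c T := by simp only [hc] at h6 ⊢; linarith
        have := mul_le_mul_of_nonneg_left this ha.le
        linarith
    _ = _ := by rw [Real.exp_add]; ring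

/-- Cauchy–Schwarz, followed by telescoping of the decrements. -/
theorem sum_Ico_le_sqrt {Δ d : ℕ → ℝ} {M : ℝ} (hM : 0 ≤ M) (h0 : ∀ t, 0 ≤ Δ t)
    (hd : ∀ t, d t ^ 2 ≤ M * (Δ t - Δ (t + 1))) {t s : ℕ} (hts : t ≤ s) :
    ∑ i ∈ Finset.Ico t s, d i ≤ √((s - t) * (M * Δ t)) := by
  apply Real.le_sqrt_of_sq_le
  have h1 : (∑ i ∈ Finset.Ico t s, d i) ^ 2 ≤ ((s - t : ℕ) : ℝ) * ∑ i ∈ Finset.Ico t s, d i ^ 2 := by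
    simpa using sq_sum_le_card_mul_sum_sq (s := Finset.Ico t s) (f := d)
  have h2 : ∑ i ∈ Finset.Ico t s, d i ^ 2 ≤ M * Δ t := by
    calc _ ≤ ∑ i ∈ Finset.Ico t s, M * (Δ i - Δ (i + 1)) := Finset.sum_le_sum fun i _ => hd i
      _ = M * (Δ t - Δ s) := by
        rw [← Finset.mul_sum]
        congr 1
        have := Finset.sum_Ico_sub Δ hts
        rw [← neg_sub, ← this, ← Finset.sum_neg_distrib]
        exact Finset.sum_congr rfl fun i _ => by ring
      _ ≤ _ := by gcongr; linarith [h0 s]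
  rw [Nat.cast_sub hts] at h1
  have : (0 : ℝ) ≤ s - t := by rw [sub_nonneg]; exact_mod_cast hts
  exact h1.trans (by gcongr)

/-- If the squares of `d` are bounded by the decrements of a sequence of order `t ^ (-1/r)`, `r < 1`,
then `d` is summable, with a polynomial bound on the tails. -/
theorem exists_sum_Ico_le_rpow {Δ d : ℕ → ℝ} {M : ℝ} (hM : 0 ≤ M) (h0 : ∀ t, 0 ≤ Δ t)
    (hd0 : ∀ t, 0 ≤ d t)
    (hd : ∀ t, d t ^ 2 ≤ M * (Δ t - Δ (t + 1))) {r C : ℝ} (hr : 0 < r) (hr1 : r < 1) (hC : 0 < C)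
    (hΔ : ∀ᶠ t : ℕ in atTop, Δ t ≤ C * (t : ℝ) ^ (-(1 / r))) :
    ∃ K : ℝ, 0 ≤ K ∧ ∃ T : ℕ, ∀ t ≥ T, ∀ s,
      ∑ i ∈ Finset.Ico t s, d i ≤ K * (t : ℝ) ^ (-((1 / r - 1) / 2)) := by
  obtain ⟨T, hT⟩ := eventually_atTop.1 (hΔ.and (eventually_gt_atTop 0))
  set κ := (1 / r - 1) / 2 with hκ
  have hκ0 : 0 < κ := by
    have : 1 < 1 / r := by rw [lt_div_iff₀ hr]; linarith
    rw [hκ]; linarith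
  set C' := √(M * C) with hC'
  have h2 : (2 : ℝ) ^ (-κ) < 1 := Real.rpow_lt_one_of_one_lt_of_neg one_lt_two (by linarith)
  -- On the dyadic window from `t` to `2t` the sum is of order `√(t Δ_t)`, that is `t^(-κ)`; `r < 1`
  -- makes `κ` positive.
  have hblock : ∀ t ≥ T, ∀ s ≤ 2 * t, ∑ i ∈ Finset.Ico t s, d i ≤ C' * (t : ℝ) ^ (-κ) := by
    intro t ht s hs
    obtain ⟨h3, h4⟩ := hT t ht
    have ht0 : (0 : ℝ) < t := by exact_mod_cast h4
    calc ∑ i ∈ Finset.Ico t s, d i ≤ ∑ i ∈ Finset.Ico t (2 * t), d i :=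
          Finset.sum_le_sum_of_subset_of_nonneg (Finset.Ico_subset_Ico_right hs)
            fun i _ _ => hd0 i
      _ ≤ √(((2 * t : ℕ) - t) * (M * Δ t)) := sum_Ico_le_sqrt hM h0 hd (by omega)
      _ ≤ √((M * C) * ((t : ℝ) ^ (-κ)) ^ 2) := by
        apply Real.sqrt_le_sqrt
        have e : ((t : ℝ) ^ (-κ)) ^ 2 = t * (t : ℝ) ^ (-(1 / r)) := by
          rw [← Real.rpow_natCast, ← Real.rpow_mul ht0.le]
          nth_rewrite 2 [← Real.rpow_one (t : ℝ)]
          rw [← Real.rpow_add ht0]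
          congr 1
          rw [hκ]; push_cast; ring
        rw [e]
        push_cast
        calc (2 * (t : ℝ) - t) * (M * Δ t) = t * M * Δ t := by ring
          _ ≤ t * M * (C * (t : ℝ) ^ (-(1 / r))) := by gcongr
          _ = _ := by ring
      _ = C' * (t : ℝ) ^ (-κ) := by
        rw [Real.sqrt_mul (by positivity), Real.sqrt_sq (by positivity)]
  -- The dyadic windows form a geometric series of ratio `2^(-κ)`; `K` is the fixed point of `K = C'
  -- + K * 2^(-κ)`.
  refine ⟨C' / (1 - 2 ^ (-κ)), div_nonneg (Real.sqrt_nonneg _) (by linarith), T, ?_⟩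
  set K := C' / (1 - 2 ^ (-κ)) with hK
  have hKC : C' + K * 2 ^ (-κ) = K := by
    have : (1 - (2 : ℝ) ^ (-κ)) ≠ 0 := by linarith
    have : K * (1 - 2 ^ (-κ)) = C' := div_mul_cancel₀ _ this
    linarith
  have hK0 : 0 ≤ K := div_nonneg (Real.sqrt_nonneg _) (by linarith)
  have main : ∀ m : ℕ, ∀ t ≥ T, ∀ s ≤ t + m,
      ∑ i ∈ Finset.Ico t s, d i ≤ K * (t : ℝ) ^ (-κ) := by
    intro m
    induction m using Nat.strong_induction_on with
    | _ m ih =>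
      intro t ht s hs
      have h4 := (hT t ht).2
      have ht0 : (0 : ℝ) < t := by exact_mod_cast h4
      rcases le_total s (2 * t) with h | h
      · refine (hblock t ht s h).trans ?_
        gcongr
        have : 0 ≤ K * (2 : ℝ) ^ (-κ) := by positivity
        linarith
      · rcases Nat.lt_or_ge t m with hm | hm
        · have h5 := ih (m - t) (by omega) (2 * t) (by omega) s (by omega)
          have h6 := hblock t ht (2 * t) le_rfl
          rw [← Finset.sum_Ico_consecutive d (show t ≤ 2 * t by omega) h]
          push_cast at h5
          rw [Real.mul_rpow (by norm_num) ht0.le] at h5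
          calc _ ≤ C' * (t : ℝ) ^ (-κ) + K * (2 ^ (-κ) * (t : ℝ) ^ (-κ)) := add_le_add h6 h5
            _ = (C' + K * 2 ^ (-κ)) * (t : ℝ) ^ (-κ) := by ring
            _ = _ := by rw [hKC]
        · have : s ≤ 2 * t := by omega
          refine (hblock t ht s this).trans ?_
          gcongr
          have : 0 ≤ K * (2 : ℝ) ^ (-κ) := by positivity
          linarith
  intro t ht s
  exact main s t ht s (by omega)

theorem summable_of_sum_Ico_le {d : ℕ → ℝ} (hd0 : ∀ t, 0 ≤ d t) {T : ℕ} {K : ℝ}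
    (h : ∀ s, ∑ i ∈ Finset.Ico T s, d i ≤ K) : Summable d := by
  rw [← summable_nat_add_iff T]
  refine summable_of_sum_range_le (c := K) (fun i => hd0 _) fun m => ?_
  have := h (T + m)
  rw [Finset.sum_Ico_eq_sum_range] at this
  simpa [add_comm] using this

theorem dist_le_of_sum_Ico_le {E : Type*} [PseudoMetricSpace E] {x : ℕ → E} {a : E}
    (hx : Tendsto x atTop (𝓝 a)) {d : ℕ → ℝ} {M : ℝ} (hM : 0 ≤ M)
    (hd : ∀ t, dist (x t) (x (t + 1)) ≤ M * d t) {t : ℕ} {K : ℝ}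
    (h : ∀ s, ∑ i ∈ Finset.Ico t s, d i ≤ K) : dist (x t) a ≤ M * K := by
  refine le_of_tendsto (tendsto_const_nhds.dist hx) ?_
  filter_upwards [eventually_ge_atTop t] with s hs
  refine (dist_le_Ico_sum_of_dist_le hs fun {k} _ _ => hd k).trans ?_
  rw [← Finset.mul_sum]
  gcongr
  exact h s

end Rates

/-! ### Independent draws and correct predictions -/

section Sampling

theorem history_eq_preimage {Ω β : Type*} {B : ℕ → Ω → β} {t : ℕ} {E : Set Ω}
    (hE : ∀ ω ω', (∀ s < t, B s ω = B s ω') → ω ∈ E → ω' ∈ E) :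
    (fun ω (s : Finset.range t) => B s ω) ⁻¹' ((fun ω (s : Finset.range t) => B s ω) '' E) = E := by
  refine Set.Subset.antisymm ?_ (Set.subset_preimage_image _ _)
  rintro ω ⟨ω', h, e⟩
  exact hE ω' ω (fun s hs => congrFun e ⟨s, Finset.mem_range.2 hs⟩) h

variable {Ω : Type*} [MeasurableSpace Ω] {μ : Measure Ω}

theorem indepFun_indicator_one_of_indepSet {s t : Set Ω} (h : IndepSet s t μ) :
    IndepFun (s.indicator (1 : Ω → ℝ)) (t.indicator (1 : Ω → ℝ)) μ := by
  have key : ∀ u : Set Ω, MeasurableSpace.comap (u.indicator (1 : Ω → ℝ)) inferInstance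
      ≤ MeasurableSpace.generateFrom {u} := fun u => by
    refine Measurable.comap_le ?_
    let _ : MeasurableSpace Ω := MeasurableSpace.generateFrom {u}
    exact measurable_one.indicator (MeasurableSpace.measurableSet_generateFrom rfl)
  exact indep_of_indep_of_le_left (indep_of_indep_of_le_right h (key t)) (key s)

theorem identDistrib_indicator_one [IsProbabilityMeasure μ] {s t : Set Ω} (hs : MeasurableSet s)
    (ht : MeasurableSet t) (h : μ s = μ t) :
    IdentDistrib (s.indicator (1 : Ω → ℝ)) (t.indicator (1 : Ω → ℝ)) μ μ := by
  have ms : Measurable (s.indicator (1 : Ω → ℝ)) := measurable_one.indicator hs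
  have mt : Measurable (t.indicator (1 : Ω → ℝ)) := measurable_one.indicator ht
  refine ⟨ms.aemeasurable, mt.aemeasurable, ?_⟩
  ext u hu
  rw [Measure.map_apply ms hu, Measure.map_apply mt hu]
  have hc : μ sᶜ = μ tᶜ := by rw [prob_compl_eq_one_sub hs, prob_compl_eq_one_sub ht, h]
  classical
  have e : ∀ w : Set Ω, w.indicator (1 : Ω → ℝ) ⁻¹' u
      = if (1 : ℝ) ∈ u then (if (0 : ℝ) ∈ u then Set.univ else w)
        else (if (0 : ℝ) ∈ u then wᶜ else ∅) := fun w => by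
    ext ω
    by_cases hω : ω ∈ w <;> by_cases h1 : (1 : ℝ) ∈ u <;> by_cases h0 : (0 : ℝ) ∈ u <;>
      simp [hω, h1, h0]
  rw [e s, e t]
  split_ifs <;> simp [h, hc]

/-- Every finite history of independent draws with positive probabilities occurs. -/
theorem exists_history {β : Type*} [MeasurableSpace β] [MeasurableSingletonClass β]
    {B : ℕ → Ω → β} [IsProbabilityMeasure μ] (hi : iIndepFun B μ)
    {p : ℝ} (hp0 : 0 < p) (hp : ∀ t b, μ.real (B t ⁻¹' {b}) = p) (t : ℕ) (x : ℕ → β) :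
    ∃ ω, ∀ s ≤ t, B s ω = x s := by
  have h := hi.measure_inter_preimage_eq_mul (Finset.range (t + 1)) (sets := fun s => {x s})
    (fun s _ => measurableSet_singleton _)
  have hne : μ (⋂ s ∈ Finset.range (t + 1), B s ⁻¹' {x s}) ≠ 0 := by
    rw [h, Finset.prod_ne_zero_iff]
    intro s _ h0
    have := hp s (x s)
    rw [Measure.real, h0] at this
    simp at this
    linarith
  obtain ⟨ω, hω⟩ := nonempty_of_measure_ne_zero hne
  refine ⟨ω, fun s hs => ?_⟩
  have := Set.mem_iInter₂.1 hω s (Finset.mem_range.2 (by omega))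
  simpa using this

variable {β : Type*} [Fintype β] [MeasurableSpace β] [MeasurableSingletonClass β] {B : ℕ → Ω → β}

/-- With finitely many values per draw, such an event is the preimage of a finite set under the
first `t` draws. Hence no measurability of the minimizers has to be assumed. -/
theorem measurableSet_of_history (hm : ∀ t, Measurable (B t)) {t : ℕ} {E : Set Ω}
    (hE : ∀ ω ω', (∀ s < t, B s ω = B s ω') → ω ∈ E → ω' ∈ E) : MeasurableSet E := by
  rw [← history_eq_preimage hE]
  exact measurableSet_preimage (measurable_pi_lambda _ fun s => hm s) (Set.toFinite _).measurableSet

theorem measureReal_history_inter (hm : ∀ t, Measurable (B t)) (hi : iIndepFun B μ) {t : ℕ}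
    {E : Set Ω} (hE : ∀ ω ω', (∀ s < t, B s ω = B s ω') → ω ∈ E → ω' ∈ E) (b : β) :
    μ.real (E ∩ B t ⁻¹' {b}) = μ.real E * μ.real (B t ⁻¹' {b}) := by
  have h := hi.indepFun_finset (Finset.range t) {t} (by simp) hm
  have h2 := h.measure_inter_preimage_eq_mul
    ((fun ω (s : Finset.range t) => B s ω) '' E)
    ((fun x : (({t} : Finset ℕ) → β) => x ⟨t, Finset.mem_singleton_self t⟩) ⁻¹' {b})
    (Set.toFinite _).measurableSet (Set.toFinite _).measurableSet
  rw [history_eq_preimage hE] at h2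
  simp only [Measure.real, ← ENNReal.toReal_mul]
  exact congrArg ENNReal.toReal h2

/-- Split `E` according to the predicted value. On each piece the prediction is a constant and the
piece is independent of the draw at time `t`. -/
theorem measureReal_history_inter_adapted [IsProbabilityMeasure μ] (hm : ∀ t, Measurable (B t))
    (hi : iIndepFun B μ)
    {p : ℝ} (hp : ∀ t b, μ.real (B t ⁻¹' {b}) = p) {t : ℕ} {g : (ℕ → β) → β}
    (hg : ∀ x y : ℕ → β, (∀ s < t, x s = y s) → g x = g y)
    {E : Set Ω} (hE : ∀ ω ω', (∀ s < t, B s ω = B s ω') → ω ∈ E → ω' ∈ E) :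
    μ.real (E ∩ {ω | B t ω = g (fun s => B s ω)}) = μ.real E * p := by
  set γ : Ω → β := fun ω => g (fun s => B s ω) with hγ
  have hγE : ∀ b, ∀ ω ω', (∀ s < t, B s ω = B s ω') → ω ∈ E ∩ γ ⁻¹' {b} → ω' ∈ E ∩ γ ⁻¹' {b} := by
    rintro b ω ω' h ⟨h1, h2⟩
    refine ⟨hE ω ω' h h1, ?_⟩
    rw [Set.mem_preimage, Set.mem_singleton_iff] at h2 ⊢
    rw [← h2]
    exact (hg _ _ h).symm
  have hE' : E = ⋃ b ∈ (Finset.univ : Finset β), (E ∩ γ ⁻¹' {b}) := by ext; simp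
  have hA : E ∩ {ω | B t ω = γ ω}
      = ⋃ b ∈ (Finset.univ : Finset β), ((E ∩ γ ⁻¹' {b}) ∩ B t ⁻¹' {b}) := by
    ext ω
    simp only [Set.mem_inter_iff, Set.mem_ofPred_eq, Finset.mem_univ, Set.iUnion_true,
      Set.mem_iUnion, Set.mem_preimage, Set.mem_singleton_iff]
    constructor
    · rintro ⟨h1, h2⟩; exact ⟨γ ω, ⟨h1, rfl⟩, h2⟩
    · rintro ⟨b, ⟨h1, h2⟩, h3⟩; exact ⟨h1, h3.trans h2.symm⟩
  have hdisj : Set.PairwiseDisjoint (↑(Finset.univ : Finset β)) fun b => E ∩ γ ⁻¹' {b} := by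
    intro b _ b' _ hbb
    refine Set.disjoint_left.2 fun ω h1 h2 => hbb ?_
    exact h1.2.symm.trans h2.2
  rw [hA, measureReal_biUnion_finset (hdisj.mono fun b => Set.inter_subset_left)
    (fun b _ => (measurableSet_of_history hm (hγE b)).inter (hm t (measurableSet_singleton b)))]
  simp only [measureReal_history_inter hm hi (hγE _), hp]
  rw [← Finset.sum_mul, ← measureReal_biUnion_finset hdisj
    (fun b _ => measurableSet_of_history hm (hγE b)), ← hE']

/-- If at every time a value is predicted from the history of independent uniform draws, then
almost surely a positive fraction of the predictions is correct. -/
theorem ae_eventually_le_sum_indicator [IsProbabilityMeasure μ] (hm : ∀ t, Measurable (B t))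
    (hi : iIndepFun B μ)
    {p : ℝ} (hp0 : 0 < p) (hp : ∀ t b, μ.real (B t ⁻¹' {b}) = p) (g : ℕ → (ℕ → β) → β)
    (hg : ∀ t, ∀ x y : ℕ → β, (∀ s < t, x s = y s) → g t x = g t y) :
    ∀ᵐ ω ∂μ, ∀ᶠ t : ℕ in atTop, p / 2 * t ≤ ∑ s ∈ Finset.range t,
      {s | B s ω = g s (fun u => B u ω)}.indicator (1 : ℕ → ℝ) s := by
  set A : ℕ → Set Ω := fun t => {ω | B t ω = g t (fun s => B s ω)} with hA
  have hAE : ∀ t, ∀ ω ω', (∀ s < t + 1, B s ω = B s ω') → ω ∈ A t → ω' ∈ A t := by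
    intro t ω ω' h h1
    have h2 : g t (fun s => B s ω) = g t (fun s => B s ω') :=
      hg t _ _ fun s hs => h s (by omega)
    exact ((h t (by omega)).symm.trans h1).trans h2
  have hmA : ∀ t, MeasurableSet (A t) := fun t => measurableSet_of_history hm (hAE t)
  have hinter : ∀ t (E : Set Ω), (∀ ω ω', (∀ s < t, B s ω = B s ω') → ω ∈ E → ω' ∈ E) →
      μ.real (E ∩ A t) = μ.real E * p := fun t E hE =>
    measureReal_history_inter_adapted hm hi hp (hg t) hE
  have hprob : ∀ t, μ.real (A t) = p := fun t => by
    simpa using hinter t Set.univ (fun _ _ _ _ => Set.mem_univ _)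
  -- The earlier event is decided by draws before time `t`, so it is a history for the later one.
  -- Pairwise independence is all that the strong law below requires.
  have hlt : ∀ s t, s < t → IndepSet (A s) (A t) μ := by
    intro s t hst
    rw [indepSet_iff_measure_inter_eq_mul (hmA s) (hmA t) (μ := μ)]
    have := hinter t (A s) fun ω ω' h => hAE s ω ω' fun u hu => h u (by omega)
    rw [← hprob t] at this
    simp only [Measure.real, ← ENNReal.toReal_mul] at this
    exact (ENNReal.toReal_eq_toReal_iff' (by finiteness) (by finiteness)).1 this
  have hindep : Pairwise (Function.onFun (fun x y : Ω → ℝ => IndepFun x y μ)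
      fun t => (A t).indicator (1 : Ω → ℝ)) := by
    intro s t hst
    rcases lt_or_gt_of_ne hst with h | h
    · exact indepFun_indicator_one_of_indepSet (hlt s t h)
    · exact (indepFun_indicator_one_of_indepSet (hlt t s h)).symm
  have hslln := strong_law_ae_real (μ := μ) (fun t => (A t).indicator (1 : Ω → ℝ))
    ((integrable_const (1 : ℝ)).indicator (hmA 0)) hindep
    (fun t => identDistrib_indicator_one (hmA t) (hmA 0) (by
      have := (hprob t).trans (hprob 0).symm
      exact (ENNReal.toReal_eq_toReal_iff' (by finiteness) (by finiteness)).1 this))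
  have hint : ∫ ω, (A 0).indicator (1 : Ω → ℝ) ω ∂μ = p := by
    rw [integral_indicator_one (hmA 0), hprob]
  filter_upwards [hslln] with ω hω
  rw [hint] at hω
  filter_upwards [hω.eventually_const_le (half_lt_self hp0), eventually_gt_atTop 0] with t ht ht0
  rw [le_div_iff₀ (by exact_mod_cast ht0)] at ht
  exact ht

end Sampling

/-! ### KL inequalities along sequences -/

section KL

variable {n : ℕ}

theorem isClosed_JOrth (J : Mat n) : IsClosed (JOrth J) := by
  have h : Continuous fun X : Mat n => Xᵀ * J * X := by fun_prop
  exact isClosed_eq h continuous_const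

/-- Here `φ'(s) = c (1 - σ) s^(-σ)` is inserted and `η` is shrunk to a real number, which leaves a
purely real inequality. -/
theorem HasKL.exists_rpow_le {f : Mat n → ℝ} {C : Set (Mat n)} {σ c : ℝ} {X : Mat n} (hX : X ∈ C)
    (h : HasKL (addIndicator f C) σ c X) : ∃ η : ℝ, 0 < η ∧ ∀ᶠ Y in 𝓝 X, Y ∈ C → f X < f Y →
      f Y < f X + η →
      (f Y - f X) ^ σ ≤ c * (1 - σ) * Metric.infDist 0 (limitingSubdiff (addIndicator f C) Y) := by
  obtain ⟨η, hη, N, hN, hKL⟩ := h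
  obtain ⟨η', h1, h2⟩ := EReal.lt_iff_exists_real_btwn.1 hη
  refine ⟨η', by exact_mod_cast h1, ?_⟩
  filter_upwards [hN] with Y hY hYC hlt hltη
  have h3 := hKL Y hY
  rw [addIndicator_of_mem f hX, addIndicator_of_mem f hYC] at h3
  have h4 : (f Y : EReal) < (f X : EReal) + η := by
    have h5 : (f Y : EReal) < (f X : EReal) + (η' : EReal) := by exact_mod_cast hltη
    exact h5.trans_le (by gcongr)
  have h5 := h3 (by exact_mod_cast hlt) h4
  rw [EReal.toReal_coe, EReal.toReal_coe] at h5
  set s := f Y - f X with hs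
  have hs0 : 0 < s := by rw [hs]; linarith
  have hd : deriv (fun s : ℝ => c * s ^ (1 - σ)) s = c * ((1 - σ) * s ^ (1 - σ - 1)) :=
    ((Real.hasDerivAt_rpow_const (Or.inl hs0.ne')).const_mul c).deriv
  rw [hd] at h5
  have e : s ^ (1 - σ - 1) = (s ^ σ)⁻¹ := by rw [← Real.rpow_neg hs0.le]; ring_nf
  have hp : 0 < s ^ σ := Real.rpow_pos_of_pos hs0 σ
  rw [e] at h5
  calc s ^ σ = s ^ σ * 1 := (mul_one _).symm
    _ ≤ s ^ σ * (Metric.infDist 0 (limitingSubdiff (addIndicator f C) Y)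
        * (c * ((1 - σ) * (s ^ σ)⁻¹))) := by gcongr
    _ = _ := by field_simp

/-- A function value sequence along a bounded sequence satisfies a KL inequality with some exponent,
uniformly over the cluster points. -/
theorem IsKLFunction.exists_eventually_rpow_le {f : Mat n → ℝ} (hf : Continuous f)
    {C : Set (Mat n)} (hC : IsClosed C) (hKL : IsKLFunction (addIndicator f C)) {x : ℕ → Mat n}
    (hxC : ∀ t, x t ∈ C) {R : ℝ} (hxR : ∀ t, ‖x t‖ ≤ R) {l : ℝ}
    (hl : Tendsto (fun t => f (x t)) atTop (𝓝 l)) (hle : ∀ t, l ≤ f (x t)) :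
    ∃ σ : ℝ, 1 / 2 < σ ∧ σ < 1 ∧ ∃ k : ℝ, 0 < k ∧ ∀ᶠ t in atTop,
      (f (x t) - l) ^ σ ≤ k * Metric.infDist 0 (limitingSubdiff (addIndicator f C) (x t)) := by
  set I : ℕ → ℝ := fun t => Metric.infDist 0 (limitingSubdiff (addIndicator f C) (x t)) with hI
  -- Exponents above `1/2` that increase to `1`, so that they eventually exceed the exponent at any
  -- given cluster point.
  let τ : ℕ → ℝ := fun j => 1 - 1 / ((j : ℝ) + 3)
  have hτ : ∀ j, 1 / 2 < τ j ∧ τ j < 1 := by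
    intro j
    have hj : (0 : ℝ) ≤ j := j.cast_nonneg
    constructor
    · have : 1 / ((j : ℝ) + 3) < 1 / 2 := one_div_lt_one_div_of_lt (by norm_num) (by linarith)
      simp only [τ]; linarith
    · have : 0 < 1 / ((j : ℝ) + 3) := by positivity
      simp only [τ]; linarith
  have hτlim : Tendsto τ atTop (𝓝 1) := by
    have h1 : Tendsto (fun j : ℕ => (j : ℝ) + 3) atTop atTop :=
      tendsto_natCast_atTop_atTop.atTop_add tendsto_const_nhds
    simpa [τ] using (tendsto_const_nhds (x := (1 : ℝ))).sub h1.inv_tendsto_atTop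
  by_contra hcon
  have hfreq : ∀ j : ℕ, ∃ᶠ t in atTop, ((j : ℝ) + 1) * I t < (f (x t) - l) ^ (τ j) := by
    intro j hj
    refine hcon ⟨τ j, (hτ j).1, (hτ j).2, (j : ℝ) + 1, by positivity, ?_⟩
    simpa only [not_lt] using hj
  -- If every pair fails, choose increasing times at which exponent `τ j` fails with constant `j +
  -- 1`, and pass to a cluster point `Y`. KL at `Y` has a smaller exponent and a smaller constant
  -- for large `j`, a contradiction.
  obtain ⟨φ, hφ, hφp⟩ := extraction_forall_of_frequently hfreq
  obtain ⟨Y, -, ψ, hψ, hlim⟩ := (isCompact_closedBall (0 : Mat n) R).tendsto_subseq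
    (x := fun j => x (φ j)) (fun j => by simpa using hxR (φ j))
  have hYC : Y ∈ C := hC.mem_of_tendsto hlim (Eventually.of_forall fun j => hxC _)
  have hsub : Tendsto (fun j => φ (ψ j)) atTop atTop := hφ.tendsto_atTop.comp hψ.tendsto_atTop
  have hfY : f Y = l := tendsto_nhds_unique ((hf.tendsto Y).comp hlim) (hl.comp hsub)
  obtain ⟨σ, hσ, c, hc, hK⟩ := hKL Y (by simp [addIndicator_of_mem f hYC])
  obtain ⟨η, hη, hN⟩ := hK.exists_rpow_le hYC
  -- The gap must also fall below `1`: only there does a larger exponent give a weaker inequality.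
  have e1 : ∀ᶠ j in atTop, f (x (φ (ψ j))) < l + min η 1 :=
    (hl.comp hsub).eventually_lt_const (by simp [hη])
  have e2 : ∀ᶠ j in atTop, σ < τ (ψ j) :=
    (hτlim.comp hψ.tendsto_atTop).eventually_const_lt hσ.2
  have e3 : ∀ᶠ j in atTop, c * (1 - σ) ≤ ((ψ j : ℕ) : ℝ) :=
    (tendsto_natCast_atTop_atTop.comp hψ.tendsto_atTop).eventually_ge_atTop _
  obtain ⟨j, h1, h2, h3, h4⟩ := ((hlim.eventually hN).and (e1.and (e2.and e3))).exists
  have h5 := hφp (ψ j)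
  simp only [Function.comp] at h1
  set t := φ (ψ j)
  have hI0 : 0 ≤ I t := Metric.infDist_nonneg
  have hpos : 0 < f (x t) - l := by
    rcases (sub_nonneg.2 (hle t)).eq_or_lt with h | h
    · rw [← h, Real.zero_rpow (by linarith [(hτ (ψ j)).1])] at h5
      have : 0 ≤ ((ψ j : ℕ) + 1 : ℝ) * I t := by positivity
      linarith
    · exact h
  have h6 := min_le_left η 1
  have h7 := min_le_right η 1
  rw [hfY] at h1
  have h8 := h1 (hxC t) (by linarith) (by linarith)
  have h9 : (f (x t) - l) ^ (τ (ψ j)) ≤ (f (x t) - l) ^ σ :=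
    Real.rpow_le_rpow_of_exponent_ge hpos (by linarith) h3.le
  have h10 : c * (1 - σ) * I t ≤ ((ψ j : ℕ) + 1 : ℝ) * I t := by gcongr; linarith
  exact absurd h5 (not_lt.2 (h9.trans (h8.trans h10)))

/-- The KL inequality along a sequence that converges to the point in question. -/
theorem HasKL.eventually_rpow_le {f : Mat n → ℝ} (hf : Continuous f)
    {C : Set (Mat n)} (hC : IsClosed C) {x : ℕ → Mat n}
    (hxC : ∀ t, x t ∈ C) {Y : Mat n} (hx : Tendsto x atTop (𝓝 Y)) (hle : ∀ t, f Y ≤ f (x t))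
    {σ c : ℝ} (hσ : 0 < σ) (hσ1 : σ < 1) (hc : 0 < c) (h : HasKL (addIndicator f C) σ c Y) :
    ∀ᶠ t in atTop, (f (x t) - f Y) ^ σ
      ≤ c * (1 - σ) * Metric.infDist 0 (limitingSubdiff (addIndicator f C) (x t)) := by
  have hYC : Y ∈ C := hC.mem_of_tendsto hx (Eventually.of_forall hxC)
  obtain ⟨η, hη, hN⟩ := h.exists_rpow_le hYC
  have e1 : ∀ᶠ t in atTop, f (x t) < f Y + η :=
    ((hf.tendsto Y).comp hx).eventually_lt_const (by linarith)
  filter_upwards [hx.eventually hN, e1] with t h1 h2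
  rcases (hle t).eq_or_lt with h3 | h3
  · rw [h3, sub_self, Real.zero_rpow hσ.ne']
    have : 0 ≤ Metric.infDist 0 (limitingSubdiff (addIndicator f C) (x t)) := Metric.infDist_nonneg
    have : 0 < 1 - σ := by linarith
    positivity
  · exact h1 (hxC t) h3 h2

end KL

/-! ### Uniform constants on bounded sets -/

section Run

variable {n : ℕ}

theorem continuous_matGrad_apply {f : Mat n → ℝ} (hf : ContDiff ℝ 1 f) (i j : Fin n) :
    Continuous fun X => matGrad f X i j :=
  (hf.continuous_fderiv one_ne_zero).clm_apply continuous_const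

theorem exists_norm_matGrad_le {f : Mat n → ℝ} (hf : ContDiff ℝ 1 f) (R : ℝ) :
    ∃ G : ℝ, 0 ≤ G ∧ ∀ X, ‖X‖ ≤ R → ‖matGrad f X‖ ≤ G := by
  have hc : Continuous fun X : Mat n => ∑ i, ∑ j, |matGrad f X i j| :=
    continuous_finsetSum _ fun i _ => continuous_finsetSum _ fun j _ =>
      (continuous_matGrad_apply hf i j).abs
  obtain ⟨G, hG⟩ := ((isCompact_closedBall (0 : Mat n) R).image hc).bddAbove
  refine ⟨n * |G|, by positivity, fun X hX => norm_le_of_abs_entry_le _ fun i j => ?_⟩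
  refine le_trans ?_ ((hG ⟨X, by simpa using hX, rfl⟩).trans (le_abs_self G))
  refine (Finset.single_le_sum (f := fun j => |matGrad f X i j|) (fun _ _ => abs_nonneg _)
    (Finset.mem_univ j)).trans ?_
  exact Finset.single_le_sum (f := fun i => ∑ j, |matGrad f X i j|)
    (fun _ _ => Finset.sum_nonneg fun _ _ => abs_nonneg _) (Finset.mem_univ i)

theorem exists_norm_le_of_coercive {f : Mat n → ℝ}
    (hcoercive : Tendsto f (comap (fun X : Mat n => ‖X‖) atTop) atTop) (a : ℝ) :
    ∃ R : ℝ, 0 ≤ R ∧ ∀ X, f X ≤ a → ‖X‖ ≤ R := by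
  obtain ⟨R, hR⟩ := eventually_atTop.1 (eventually_comap.1 (hcoercive.eventually_gt_atTop a))
  refine ⟨max R 0, le_max_right _ _, fun X hX => ?_⟩
  by_contra h
  exact absurd hX (not_le.2 (hR ‖X‖ ((le_max_left _ _).trans (not_le.1 h).le) X rfl))

theorem exists_norm_U_le (n : ℕ) : ∃ M : ℝ, 0 ≤ M ∧ ∀ b : Block n, ‖b.U‖ ≤ M :=
  ⟨∑ b : Block n, ‖b.U‖, Finset.sum_nonneg fun _ _ => norm_nonneg _, fun b =>
    Finset.single_le_sum (f := fun b : Block n => ‖b.U‖) (fun _ _ => norm_nonneg _)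
      (Finset.mem_univ b)⟩

theorem norm_block_mul_le {M : ℝ} (hM : 0 ≤ M) {b : Block n} (hb : ‖b.U‖ ≤ M) (C : Mat 2)
    (X : Mat n) : ‖b.U * C * (b.Uᵀ * X)‖ ≤ M * ‖C‖ * (M * ‖X‖) := by
  refine (Matrix.frobenius_norm_mul _ _).trans ?_
  gcongr
  · exact (Matrix.frobenius_norm_mul _ _).trans (by gcongr)
  · refine (Matrix.frobenius_norm_mul _ _).trans ?_
    rw [Matrix.frobenius_norm_transpose]
    gcongr

/-- One constant for both choices of `Q`: the first summand serves `Qlow`, the second a multiple of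
the identity, and `θ` the proximal term. -/
theorem abs_vec_dotProduct_admissible_le {H : Matrix (Fin n × Fin n) (Fin n × Fin n) ℝ} {L θ R M : ℝ}
    (hL : 0 < L) (hθ : 0 < θ) (hHL : specNorm H ≤ L) {X : Mat n} (hX : ‖X‖ ≤ R) (hM : 0 ≤ M)
    {b : Block n} (hb : ‖b.U‖ ≤ M) {Q : Matrix (Fin 2 × Fin 2) (Fin 2 × Fin 2) ℝ}
    (hQ : AdmissibleQ H L X b Q) (C D : Mat 2) :
    |C.vec ⬝ᵥ ((Q + θ • 1) *ᵥ D.vec)| ≤ (L * (M * (M * R)) ^ 2 + L + θ) * ‖C‖ * ‖D‖ := by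
  have hR : 0 ≤ R := (norm_nonneg _).trans hX
  have hQ' : |C.vec ⬝ᵥ (Q *ᵥ D.vec)| ≤ (L * (M * (M * R)) ^ 2 + L) * ‖C‖ * ‖D‖ := by
    rcases hQ with rfl | ⟨s, hs, hsL, rfl⟩
    · rw [vec_dotProduct_Qlow_mulVec]
      calc _ ≤ specNorm H * ‖b.U * C * (b.Uᵀ * X)‖ * ‖b.U * D * (b.Uᵀ * X)‖ :=
            abs_vec_dotProduct_mulVec_le _ _ _
        _ ≤ L * (M * ‖C‖ * (M * R)) * (M * ‖D‖ * (M * R)) := by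
            gcongr
            · exact (norm_block_mul_le hM hb C X).trans (by gcongr)
            · exact (norm_block_mul_le hM hb D X).trans (by gcongr)
        _ = (L * (M * (M * R)) ^ 2) * (‖C‖ * ‖D‖) := by ring
        _ ≤ (L * (M * (M * R)) ^ 2 + L) * (‖C‖ * ‖D‖) := by gcongr; linarith
        _ = _ := by ring
    · have hs0 : 0 ≤ s := (specNorm_nonneg _).trans hs
      rw [vec_dotProduct_smul_one_mulVec, abs_mul, abs_of_nonneg hs0]
      calc s * |C.vec ⬝ᵥ D.vec| ≤ L * (‖C‖ * ‖D‖) := by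
            gcongr
            exact abs_vec_dotProduct_le C D
        _ ≤ (L * (M * (M * R)) ^ 2 + L) * (‖C‖ * ‖D‖) := by
            gcongr
            have : 0 ≤ L * (M * (M * R)) ^ 2 := by positivity
            linarith
        _ = _ := by ring
  have h2 : |θ * (C.vec ⬝ᵥ D.vec)| ≤ θ * (‖C‖ * ‖D‖) := by
    rw [abs_mul, abs_of_pos hθ]
    gcongr
    exact abs_vec_dotProduct_le C D
  rw [Matrix.add_mulVec, dotProduct_add, vec_dotProduct_smul_one_mulVec]
  calc _ ≤ _ := abs_add_le _ _
    _ ≤ (L * (M * (M * R)) ^ 2 + L) * ‖C‖ * ‖D‖ + θ * (‖C‖ * ‖D‖) := add_le_add hQ' h2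
    _ = _ := by ring

/-- The step length bounds the entry of the Riemannian gradient that belongs to the block. -/
theorem exists_skew_le_of_isMinOn {J : Mat n} {ε : Fin n → ℝ} (hε : ∀ i, ε i = 1 ∨ ε i = -1)
    (hJ : J = Matrix.diagonal ε) (f : Mat n → ℝ) {H : Matrix (Fin n × Fin n) (Fin n × Fin n) ℝ}
    {L θ : ℝ} (hL : 0 < L) (hθ : 0 < θ) (hHL : specNorm H ≤ L) {R G D : ℝ} (hG : 0 ≤ G)
    (hD : 0 ≤ D) :
    ∃ K : ℝ, 0 < K ∧ ∀ X : Mat n, ‖X‖ ≤ R → ‖matGrad f X‖ ≤ G → ∀ (b : Block n)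
      (Q : Matrix (Fin 2 × Fin 2) (Fin 2 × Fin 2) ℝ) (V : Mat 2), AdmissibleQ H L X b Q →
      V ∈ JOrth (b.sub J) → IsMinOn (majorizer f θ Q X b) (JOrth (b.sub J)) V → ‖V - 1‖ ≤ D →
      |ε b.1.1 * (matGrad f X * Xᵀ) b.1.1 b.1.2 - ε b.1.2 * (matGrad f X * Xᵀ) b.1.2 b.1.1|
        ≤ K * ‖V - 1‖ := by
  obtain ⟨M, hM, hU⟩ := exists_norm_U_le n
  set q := L * (M * (M * R)) ^ 2 + L + θ with hq
  have hq0 : 0 < q := by positivity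
  refine ⟨2 * (M * (M * (G * |R|)) + q * (D + 2)), by positivity, ?_⟩
  intro X hX hGX b Q V hQ hV hmin hVD
  have hsub : b.sub J = Matrix.diagonal (ε ∘ b.idx) := by rw [hJ, b.sub_diagonal]
  rw [hsub] at hV hmin
  have hmin' : IsMinOn (fun W => (1 / 2) * quadForm (Q + θ • 1) (W - 1)
      + frobInner (W - 1) (b.sub (matGrad f X * Xᵀ))) (JOrth (Matrix.diagonal (ε ∘ b.idx))) V := by
    intro W hW
    have h : majorizer f θ Q X b V ≤ majorizer f θ Q X b W := hmin hW
    rw [majorizer, majorizer] at h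
    simp only [Set.mem_ofPred_eq]
    linarith
  have h := abs_skew_le_of_isMinOn (ε ∘ b.idx) (fun i => hε _) (Q + θ • 1)
    (abs_vec_dotProduct_admissible_le hL hθ hHL hX hM (hU b) hQ) (b.sub (matGrad f X * Xᵀ)) V hV
    hmin'
  have hA : ‖b.sub (matGrad f X * Xᵀ)‖ ≤ M * (M * (G * |R|)) := by
    rw [← b.transpose_U_mul_mul_U, Matrix.mul_assoc]
    refine (Matrix.frobenius_norm_mul _ _).trans ?_
    rw [Matrix.frobenius_norm_transpose]
    gcongr
    · exact hU b
    · refine (Matrix.frobenius_norm_mul _ _).trans ?_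
      rw [mul_comm M]
      gcongr
      · refine (Matrix.frobenius_norm_mul _ _).trans ?_
        rw [Matrix.frobenius_norm_transpose]
        gcongr
        exact hX.trans (le_abs_self R)
      · exact hU b
  refine h.trans ?_
  gcongr

end Run

/-! ### Adaptedness, the longest-step block, and good times -/

section Trajectory

variable {n : ℕ} {Ω : Type*} [MeasurableSpace Ω] {μ : Measure Ω} {J : Mat n} {f : Mat n → ℝ}
  {H : Matrix (Fin n × Fin n) (Fin n × Fin n) ℝ} {L θ : ℝ} {X₀ : Mat n} {B : ℕ → Ω → Block n}
  {V : ℕ → Ω → Mat 2} {X : ℕ → Ω → Mat n}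

theorem IsGSJOBCD.iterate_eq (hrun : IsGSJOBCD μ J f H L θ X₀ B V X) {ω ω' : Ω} (t : ℕ)
    (h : ∀ s < t, B s ω = B s ω') : X t ω = X t ω' := by
  induction t with
  | zero => rw [hrun.init, hrun.init]
  | succ t ih =>
    rw [hrun.step, hrun.step, ih fun s hs => h s (by omega), h t (by omega),
      hrun.history t ω ω' fun s hs => h s (by omega)]

theorem IsGSJOBCD.mem_JOrth (hrun : IsGSJOBCD μ J f H L θ X₀ B V X) {ε : Fin n → ℝ}
    (hJ : J = Matrix.diagonal ε) (hX₀ : X₀ ∈ JOrth J) (t : ℕ) (ω : Ω) : X t ω ∈ JOrth J := by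
  induction t with
  | zero => rwa [hrun.init]
  | succ t ih => rw [hrun.step]; exact JOrth_step hJ ih _ (hrun.mem t ω)

theorem IsGSJOBCD.descent (hrun : IsGSJOBCD μ J f H L θ X₀ B V X)
    (hupper : ∀ X Y : Mat n, f Y ≤ f X + frobInner (Y - X) (matGrad f X)
      + (1 / 2) * quadForm H (Y - X)) (t : ℕ) (ω : Ω) :
    f (X (t + 1) ω) + θ / 2 * ‖V t ω - 1‖ ^ 2 ≤ f (X t ω) := by
  obtain ⟨Q, hQ, hmin⟩ := hrun.isMin t ω
  rw [hrun.step]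
  exact JOBCD.descent hupper hQ hmin

theorem IsGSJOBCD.le_init (hrun : IsGSJOBCD μ J f H L θ X₀ B V X) (hθ : 0 < θ)
    (hupper : ∀ X Y : Mat n, f Y ≤ f X + frobInner (Y - X) (matGrad f X)
      + (1 / 2) * quadForm H (Y - X)) (t : ℕ) (ω : Ω) : f (X t ω) ≤ f X₀ := by
  induction t with
  | zero => rw [hrun.init]
  | succ t ih =>
    have := hrun.descent hupper t ω
    have : 0 ≤ θ / 2 * ‖V t ω - 1‖ ^ 2 := by positivity
    linarith

theorem one_div_choose_pos (hn : 2 ≤ n) : 0 < 1 / (n.choose 2 : ℝ) := by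
  have := Nat.choose_pos hn
  positivity

/-- There is an adapted prediction of the block such that, whenever the prediction is correct, the
step taken is the longest among those of all blocks. -/
theorem IsGSJOBCD.exists_argmax [IsProbabilityMeasure μ] (hn : 2 ≤ n)
    (hrun : IsGSJOBCD μ J f H L θ X₀ B V X) :
    ∃ g : ℕ → (ℕ → Block n) → Block n,
      (∀ t, ∀ x y : ℕ → Block n, (∀ s < t, x s = y s) → g t x = g t y) ∧
      ∀ t ω, B t ω = g t (fun s => B s ω) → ∀ b : Block n, ∃ ω', X t ω' = X t ω ∧ B t ω' = b ∧
        ‖V t ω' - 1‖ ≤ ‖V t ω - 1‖ := by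
  have hhist := fun t x =>
    exists_history hrun.indep_block (one_div_choose_pos hn) hrun.uniform_block t x
  -- `w t x` is a sample point whose draws up to time `t` are `x`. The steps of blocks not drawn are
  -- read off at such points; by `history` the choice of point is immaterial.
  choose w hw using hhist
  let v : ℕ → (ℕ → Block n) → ℝ := fun t x => ‖V t (w t x) - 1‖
  have hv : ∀ t ω x, (∀ s ≤ t, B s ω = x s) → ‖V t ω - 1‖ = v t x := by
    intro t ω x h
    simp only [v]
    rw [hrun.history t ω (w t x) fun s hs => (h s hs).trans (hw t x s hs).symm]
  have hvc : ∀ t x y, (∀ s ≤ t, x s = y s) → v t x = v t y := fun t x y h =>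
    hv t (w t x) y fun s hs => (hw t x s hs).trans (h s hs)
  have : Nonempty (Block n) := ⟨⟨(⟨0, by omega⟩, ⟨1, by omega⟩), by simp⟩⟩
  have hmax : ∀ h : Block n → ℝ, ∃ b, ∀ b', h b' ≤ h b := fun h => Finite.exists_max h
  choose a ha using hmax
  -- The draw at time `t` is overwritten by each candidate `b`, so the maximizer depends on the
  -- draws before `t` only.
  refine ⟨fun t x => a fun b => v t (Function.update x t b), ?_, ?_⟩
  · intro t x y h
    have : (fun b => v t (Function.update x t b)) = fun b => v t (Function.update y t b) := by
      funext b
      refine hvc t _ _ fun s hs => ?_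
      rcases hs.eq_or_lt with rfl | hs
      · simp
      · rw [Function.update_of_ne hs.ne, Function.update_of_ne hs.ne, h s hs]
    simp only [this]
  · intro t ω hB b
    set x : ℕ → Block n := fun s => B s ω
    have hx := hw t (Function.update x t b)
    refine ⟨w t (Function.update x t b), ?_, ?_, ?_⟩
    · refine hrun.iterate_eq t fun s hs => ?_
      rw [hx s hs.le, Function.update_of_ne hs.ne]
    · rw [hx t le_rfl, Function.update_self]
    · have h1 := ha (fun b => v t (Function.update x t b)) b
      simp only at hB h1
      rw [← hB, show Function.update x t (B t ω) = x from Function.update_eq_self t x] at h1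
      rw [hv t ω x fun s _ => rfl]
      exact h1

/-- The facts about the trajectories that determine the convergence. -/
theorem IsGSJOBCD.exists_trajectory_bounds [IsProbabilityMeasure μ] (hn : 2 ≤ n)
    {ε : Fin n → ℝ} (hε : ∀ i, ε i = 1 ∨ ε i = -1) (hJ : J = Matrix.diagonal ε)
    (hf : ContDiff ℝ 1 f) (hL : 0 < L) (hHL : specNorm H ≤ L)
    (hupper : ∀ X Y : Mat n, f Y ≤ f X + frobInner (Y - X) (matGrad f X)
      + (1 / 2) * quadForm H (Y - X))
    (hcoercive : Tendsto f (comap (fun X : Mat n => ‖X‖) atTop) atTop) (hθ : 0 < θ)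
    (hX₀ : X₀ ∈ JOrth J) (hrun : IsGSJOBCD μ J f H L θ X₀ B V X) :
    ∃ R m K₁ K₂ : ℝ, 0 ≤ K₁ ∧ 0 < K₂ ∧
      (∀ t ω, ‖X t ω‖ ≤ R ∧ m ≤ f (X t ω) ∧ dist (X t ω) (X (t + 1) ω) ≤ K₁ * ‖V t ω - 1‖) ∧
      ∀ᵐ ω ∂μ, ∃ G : Set ℕ, (∀ t ∈ G, Metric.infDist 0
          (limitingSubdiff (addIndicator f (JOrth J)) (X t ω)) ≤ K₂ * ‖V t ω - 1‖) ∧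
        ∀ᶠ t : ℕ in atTop, 1 / (n.choose 2 : ℝ) / 2 * t
          ≤ ∑ s ∈ Finset.range t, G.indicator (1 : ℕ → ℝ) s := by
  obtain ⟨R, hR, hRX⟩ := exists_norm_le_of_coercive hcoercive (f X₀)
  have hXR : ∀ t ω, ‖X t ω‖ ≤ R := fun t ω => hRX _ (hrun.le_init hθ hupper t ω)
  obtain ⟨M, hM, hU⟩ := exists_norm_U_le n
  have hcomp := isCompact_closedBall (0 : Mat n) R
  obtain ⟨m, hm⟩ := (hcomp.image hf.continuous).bddBelow
  have hmX : ∀ t ω, m ≤ f (X t ω) := fun t ω =>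
    hm ⟨X t ω, by simpa using hXR t ω, rfl⟩
  obtain ⟨G₀, hG₀, hG⟩ := exists_norm_matGrad_le hf R
  have hd : ∀ t ω, ‖V t ω - 1‖ ≤ 1 + |2 * (f X₀ - m) / θ| := fun t ω => by
    have h1 := hrun.descent hupper t ω
    have h2 := hrun.le_init hθ hupper t ω
    have h3 := hmX (t + 1) ω
    have h4 : ‖V t ω - 1‖ ^ 2 ≤ 2 * (f X₀ - m) / θ := by
      rw [le_div_iff₀ hθ]; linarith
    have h5 := le_abs_self (2 * (f X₀ - m) / θ)
    nlinarith [sq_nonneg (‖V t ω - 1‖ - 1)]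
  obtain ⟨K, hK, hskew⟩ := exists_skew_le_of_isMinOn hε hJ f (H := H) (R := R) hL hθ hHL
    (G := G₀) hG₀ (D := 1 + |2 * (f X₀ - m) / θ|) (by positivity)
  obtain ⟨g, hg, hgood⟩ := hrun.exists_argmax hn
  refine ⟨R, m, M * (M * R), n * K * (n * R * n) + 1, by positivity, by positivity,
    fun t ω => ⟨hXR t ω, hmX t ω, ?_⟩, ?_⟩
  · rw [dist_comm, dist_eq_norm, hrun.step, add_sub_cancel_left, Matrix.mul_assoc _ _ (X t ω)]
    calc _ ≤ M * ‖V t ω - 1‖ * (M * ‖X t ω‖) := norm_block_mul_le hM (hU _) _ _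
      _ ≤ M * ‖V t ω - 1‖ * (M * R) := by gcongr; exact hXR t ω
      _ = _ := by ring
  · filter_upwards [ae_eventually_le_sum_indicator hrun.measurable_block hrun.indep_block
      (one_div_choose_pos hn) hrun.uniform_block g hg] with ω hω
    refine ⟨_, fun t ht => ?_, hω⟩
    have hlt : ∀ i j : Fin n, i < j → |ε i * (matGrad f (X t ω) * (X t ω)ᵀ) i j
        - ε j * (matGrad f (X t ω) * (X t ω)ᵀ) j i| ≤ K * ‖V t ω - 1‖ := by
      intro i j hij
      -- At `ω'` the iterate is the same but block `(i, j)` is drawn. Its step bounds the entry `(i,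
      -- j)`, and it is no longer than the step at `ω`.
      obtain ⟨ω', h1, h2, h3⟩ := hgood t ω ht ⟨(i, j), hij⟩
      obtain ⟨Q, hQ, hmin⟩ := hrun.isMin t ω'
      have hmem := hrun.mem t ω'
      rw [h1, h2] at hQ hmin
      rw [h2] at hmem
      exact (hskew (X t ω) (hXR t ω) (hG _ (hXR t ω)) ⟨(i, j), hij⟩ Q (V t ω') hQ hmem hmin
        (hd t ω')).trans (by gcongr)
    have hall : ∀ i j : Fin n, |ε i * (matGrad f (X t ω) * (X t ω)ᵀ) i j
        - ε j * (matGrad f (X t ω) * (X t ω)ᵀ) j i| ≤ K * ‖V t ω - 1‖ := by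
      intro i j
      rcases lt_trichotomy i j with h | rfl | h
      · exact hlt i j h
      · rw [sub_self, abs_zero]; positivity
      · rw [abs_sub_comm]; exact hlt j i h
    have hdiff : DifferentiableAt ℝ f (X t ω) := hf.differentiable one_ne_zero _
    calc _ ≤ n * (K * ‖V t ω - 1‖) * (n * ‖X t ω‖ * n) :=
          infDist_limitingSubdiff_le hε hJ hdiff (hrun.mem_JOrth hJ hX₀ t ω) hall
      _ ≤ n * (K * ‖V t ω - 1‖) * (n * R * n) := by gcongr; exact hXR t ω
      _ = n * K * (n * R * n) * ‖V t ω - 1‖ := by ring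
      _ ≤ _ := by gcongr; linarith

end Trajectory

/-! ### From KL and good times to tails of the step lengths -/

section Convergence

theorem decrease_of_rpow_le {Δ Δ' d I σ k K θ : ℝ} (hΔ : 0 ≤ Δ) (hk : 0 < k) (hK : 0 < K)
    (hθ : 0 < θ) (h1 : Δ ^ σ ≤ k * I) (h2 : I ≤ K * d) (h3 : Δ' + θ / 2 * d ^ 2 ≤ Δ) :
    Δ' ≤ Δ - θ / 2 / (k * K) ^ 2 * Δ ^ (2 * σ) := by
  have h4 : Δ ^ σ ≤ k * K * d := by
    calc Δ ^ σ ≤ k * I := h1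
      _ ≤ k * (K * d) := by gcongr
      _ = _ := by ring
  have h5 : Δ ^ (2 * σ) ≤ (k * K * d) ^ 2 := by
    have : Δ ^ (2 * σ) = (Δ ^ σ) ^ 2 := by
      rw [mul_comm, Real.rpow_mul hΔ, Real.rpow_two]
    rw [this]
    have := Real.rpow_nonneg hΔ σ
    gcongr
  have h6 : θ / 2 / (k * K) ^ 2 * Δ ^ (2 * σ) ≤ θ / 2 * d ^ 2 := by
    calc _ ≤ θ / 2 / (k * K) ^ 2 * (k * K * d) ^ 2 := by gcongr
      _ = _ := by field_simp
  linarith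

variable {Δ d I : ℕ → ℝ} {G : Set ℕ} {q k K θ : ℝ}

/-- Polynomial bound for the tails of the step lengths under a KL inequality with exponent
`σ > 1/2`. -/
theorem exists_sum_Ico_le_of_KL (hΔ : ∀ t, 0 ≤ Δ t) (hd : ∀ t, 0 ≤ d t) (hθ : 0 < θ)
    (hdesc : ∀ t, Δ (t + 1) + θ / 2 * d t ^ 2 ≤ Δ t) (hq : 0 < q)
    (hcount : ∀ᶠ t : ℕ in atTop, q * t ≤ ∑ s ∈ Finset.range t, G.indicator (1 : ℕ → ℝ) s)
    (hK : 0 < K) (hG : ∀ t ∈ G, I t ≤ K * d t) {σ : ℝ} (hσ : 1 / 2 < σ) (hσ1 : σ < 1) (hk : 0 < k)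
    (hKL : ∀ᶠ t in atTop, Δ t ^ σ ≤ k * I t) :
    ∃ C : ℝ, 0 ≤ C ∧ ∃ T : ℕ, ∀ t ≥ T, ∀ s,
      ∑ i ∈ Finset.Ico t s, d i ≤ C * (t : ℝ) ^ (-((1 - σ) / (2 * σ - 1))) := by
  have hanti : Antitone Δ := antitone_nat_of_succ_le fun t => by
    have := hdesc t
    have : 0 ≤ θ / 2 * d t ^ 2 := by positivity
    linarith
  obtain ⟨T, hT⟩ := eventually_atTop.1 hKL
  have hr : 0 < 2 * σ - 1 := by linarith
  have hr1 : 2 * σ - 1 < 1 := by linarith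
  obtain ⟨C, hC, hrate⟩ := eventually_le_rpow_of_decrease hΔ hanti hq hcount hr hr1.le
    (a := θ / 2 / (k * K) ^ 2) (by positivity) (T := T) (fun t ht htG => by
      have := decrease_of_rpow_le (hΔ t) hk hK hθ (hT t ht) (hG t htG) (hdesc t)
      rwa [add_sub_cancel])
  have hsq : ∀ t, d t ^ 2 ≤ 2 / θ * (Δ t - Δ (t + 1)) := fun t => by
    rw [div_mul_eq_mul_div, le_div_iff₀ hθ]
    linarith [hdesc t]
  have h := exists_sum_Ico_le_rpow (by positivity) hΔ hd hsq hr hr1 hC hrate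
  have e : (1 / (2 * σ - 1) - 1) / 2 = (1 - σ) / (2 * σ - 1) := by
    field_simp; ring
  rwa [e] at h

/-- Geometric bound for the tails of the step lengths under a KL inequality with exponent
`1/2`. -/
theorem exists_sum_Ico_le_exp_of_KL (hΔ : ∀ t, 0 ≤ Δ t) (hθ : 0 < θ)
    (hdesc : ∀ t, Δ (t + 1) + θ / 2 * d t ^ 2 ≤ Δ t) (hq : 0 < q)
    (hcount : ∀ᶠ t : ℕ in atTop, q * t ≤ ∑ s ∈ Finset.range t, G.indicator (1 : ℕ → ℝ) s)
    (hK : 0 < K) (hG : ∀ t ∈ G, I t ≤ K * d t) (hk : 0 < k)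
    (hKL : ∀ᶠ t in atTop, Δ t ^ (1 / 2 : ℝ) ≤ k * I t) :
    ∃ C : ℝ, ∃ T : ℕ, ∀ t ≥ T, ∀ s,
      ∑ i ∈ Finset.Ico t s, d i ≤ C * Real.exp (-(θ / 2 / (k * K) ^ 2 * q / 2) * t) := by
  have hanti : Antitone Δ := antitone_nat_of_succ_le fun t => by
    have := hdesc t
    have : 0 ≤ θ / 2 * d t ^ 2 := by positivity
    linarith
  obtain ⟨T, hT⟩ := eventually_atTop.1 hKL
  obtain ⟨C, hC, hrate⟩ := eventually_le_exp_of_decrease hΔ hanti hcount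
    (a := θ / 2 / (k * K) ^ 2) (by positivity) (T := T) (fun t ht htG => by
      have := decrease_of_rpow_le (hΔ t) hk hK hθ (hT t ht) (hG t htG) (hdesc t)
      norm_num at this ⊢
      exact this)
  set a := θ / 2 / (k * K) ^ 2 with ha
  have ha0 : 0 < a := by positivity
  obtain ⟨T', hT'⟩ := eventually_atTop.1 hrate
  -- `Δ` decays at rate `a q`; a step is at most of the order of the square root of `Δ`, which
  -- halves the rate.
  set ρ := Real.exp (-(a * q / 2)) with hρ
  have hρ1 : ρ < 1 := Real.exp_lt_one_iff.2 (by rw [neg_lt_zero]; positivity)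
  have hpow : ∀ t : ℕ, ρ ^ t = Real.exp (-(a * q / 2) * t) := fun t => by
    rw [hρ, ← Real.exp_nat_mul, mul_comm]
  set D := √(2 / θ * C) with hD
  have hdt : ∀ t ≥ T', d t ≤ D * ρ ^ t := by
    intro t ht
    have h1 : d t ^ 2 ≤ 2 / θ * C * (ρ ^ t) ^ 2 := by
      have e : (ρ ^ t) ^ 2 = Real.exp (-(a * q) * t) := by
        rw [hpow, ← Real.exp_nat_mul]; congr 1; push_cast; ring
      rw [e]
      calc d t ^ 2 ≤ 2 / θ * Δ t := by
            rw [div_mul_eq_mul_div, le_div_iff₀ hθ]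
            linarith [hdesc t, hΔ (t + 1)]
        _ ≤ 2 / θ * (C * Real.exp (-(a * q) * t)) := by gcongr; exact hT' t ht
        _ = _ := by ring
    have h2 := Real.le_sqrt_of_sq_le h1
    rwa [Real.sqrt_mul (by positivity), Real.sqrt_sq (by positivity)] at h2
  refine ⟨D / (1 - ρ), T', fun t ht s => ?_⟩
  calc ∑ i ∈ Finset.Ico t s, d i ≤ ∑ i ∈ Finset.Ico t s, D * ρ ^ i :=
        Finset.sum_le_sum fun i hi => hdt i (ht.trans (Finset.mem_Ico.1 hi).1)
    _ = D * ∑ i ∈ Finset.Ico t s, ρ ^ i := by rw [Finset.mul_sum]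
    _ ≤ D * (ρ ^ t / (1 - ρ)) := by
        gcongr
        exact geom_sum_Ico_le_of_lt_one (Real.exp_pos _).le hρ1
    _ = _ := by rw [hpow]; ring

end Convergence

end JOBCD

/-! ### The convergence theorem -/

theorem mainTheorem7
    {n : ℕ} (hn : 2 ≤ n)
    -- the signature matrix
    (J : JOBCD.Mat n) (ε : Fin n → ℝ) (hε : ∀ i, ε i = 1 ∨ ε i = -1) (hJ : J = Matrix.diagonal ε)
    -- the objective: continuously differentiable, with a quadratic upper bound, coercive
    (f : JOBCD.Mat n → ℝ) (hf : ContDiff ℝ 1 f)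
    (H : Matrix (Fin n × Fin n) (Fin n × Fin n) ℝ) (hH : H.PosSemidef)
    (L : ℝ) (hL : 0 < L) (hHL : JOBCD.specNorm H ≤ L)
    (hupper : ∀ X Y : JOBCD.Mat n, f Y ≤ f X + JOBCD.frobInner (Y - X) (JOBCD.matGrad f X)
      + (1 / 2) * JOBCD.quadForm H (Y - X))
    (hcoercive : Tendsto f (comap (fun X : JOBCD.Mat n => ‖X‖) atTop) atTop)
    -- `f` plus the indicator function of the J-orthogonality constraint is a KL function
    (hKL : JOBCD.IsKLFunction (JOBCD.addIndicator f (JOBCD.JOrth J)))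
    -- a run of GS-JOBCD
    (θ : ℝ) (hθ : 0 < θ)
    {Ω : Type*} [MeasurableSpace Ω] (μ : Measure Ω) [IsProbabilityMeasure μ]
    (X₀ : JOBCD.Mat n) (hX₀ : X₀ ∈ JOBCD.JOrth J)
    (B : ℕ → Ω → JOBCD.Block n) (V : ℕ → Ω → JOBCD.Mat 2) (X : ℕ → Ω → JOBCD.Mat n)
    (hrun : JOBCD.IsGSJOBCD μ J f H L θ X₀ B V X) :
    -- almost surely the iterates converge, and `d_0 = ∑ ‖V^i - I‖` is finite
    (∀ᵐ ω ∂μ, (∃ Xinf, Tendsto (fun t => X t ω) atTop (𝓝 Xinf)) ∧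
      Summable (fun i => ‖V i ω - 1‖)) ∧
    -- (a)
    (∀ σ ∈ Ioc (1 / 4 : ℝ) (1 / 2), ∀ c : ℝ, 0 < c → ∃ γ : ℝ, 0 < γ ∧ ∀ᵐ ω ∂μ, ∀ Xinf,
      Tendsto (fun t => X t ω) atTop (𝓝 Xinf) →
      JOBCD.HasKL (JOBCD.addIndicator f (JOBCD.JOrth J)) σ c Xinf →
      ∃ (C : ℝ) (t' : ℕ), ∀ t ≥ t', ‖X t ω - Xinf‖ ≤ C * Real.exp (-γ * t)) ∧
    -- (b)
    (∀ σ ∈ Ioo (1 / 2 : ℝ) 1, ∀ τ : ℝ, τ = (2 * σ - 1) / (1 - σ) → ∀ᵐ ω ∂μ, ∀ Xinf,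
      Tendsto (fun t => X t ω) atTop (𝓝 Xinf) →
      ∀ c : ℝ, 0 < c → JOBCD.HasKL (JOBCD.addIndicator f (JOBCD.JOrth J)) σ c Xinf →
      ∃ (C : ℝ) (t' : ℕ), ∀ t ≥ t', ‖X t ω - Xinf‖ ≤ C * (1 / (t : ℝ) ^ (1 / τ))) := by
  have hn0 := JOBCD.one_div_choose_pos hn
  have hclosed := JOBCD.isClosed_JOrth J
  have hmem := hrun.mem_JOrth hJ hX₀
  have hdesc := hrun.descent hupper
  have hanti : ∀ ω, Antitone fun t => f (X t ω) := fun ω => antitone_nat_of_succ_le fun t => by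
    have := hdesc t ω
    have : 0 ≤ θ / 2 * ‖V t ω - 1‖ ^ 2 := by positivity
    linarith
  obtain ⟨R, m, K₁, K₂, hK₁, hK₂, hbd, hae⟩ :=
    hrun.exists_trajectory_bounds hn hε hJ hf hL hHL hupper hcoercive hθ hX₀
  have hlim : ∀ ω Xinf, Tendsto (fun t => X t ω) atTop (𝓝 Xinf) → ∀ t, f Xinf ≤ f (X t ω) :=
    fun ω Xinf h => (hanti ω).le_of_tendsto ((hf.continuous.tendsto Xinf).comp h)
  have hdescΔ : ∀ ω (l : ℝ) t, (f (X (t + 1) ω) - l) + θ / 2 * ‖V t ω - 1‖ ^ 2 ≤ f (X t ω) - l :=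
    fun ω l t => by linarith [hdesc t ω]
  have hq : 0 < 1 / (n.choose 2 : ℝ) / 2 := half_pos hn0
  refine ⟨?_, ?_, ?_⟩
  · filter_upwards [hae] with ω hω
    obtain ⟨G, hG, hcount⟩ := hω
    have hbdd : BddBelow (range fun t => f (X t ω)) :=
      ⟨m, by rintro _ ⟨t, rfl⟩; exact (hbd t ω).2.1⟩
    have hl := tendsto_atTop_ciInf (hanti ω) hbdd
    have hle : ∀ t, ⨅ t, f (X t ω) ≤ f (X t ω) := fun t => ciInf_le hbdd t
    -- No limit is available yet, hence the version over all cluster points. Its exponent and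
    -- constant may depend on `ω`, which is harmless for summability.
    obtain ⟨σ, hσ, hσ1, k, hk, hev⟩ := hKL.exists_eventually_rpow_le hf.continuous hclosed
      (fun t => hmem t ω) (fun t => (hbd t ω).1) hl hle
    obtain ⟨C, -, T, hT⟩ := JOBCD.exists_sum_Ico_le_of_KL (d := fun t => ‖V t ω - 1‖)
      (fun t => sub_nonneg.2 (hle t)) (fun t => norm_nonneg _) hθ (hdescΔ ω _) hq hcount hK₂ hG
      hσ hσ1 hk hev
    have hsum : Summable fun t => ‖V t ω - 1‖ :=
      JOBCD.summable_of_sum_Ico_le (fun t => norm_nonneg _) (hT T le_rfl)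
    refine ⟨cauchySeq_tendsto_of_complete (cauchySeq_of_summable_dist ?_), hsum⟩
    exact Summable.of_nonneg_of_le (fun _ => dist_nonneg) (fun t => (hbd t ω).2.2)
      (hsum.mul_left K₁)
  · intro σ hσ c hc
    have hσ1 : 0 < 1 - σ := by linarith [hσ.2]
    -- All ingredients are deterministic: `K₂` is uniform over trajectories, and the density of good
    -- times is bounded below by a constant.
    refine ⟨θ / 2 / (c * (1 - σ) * K₂) ^ 2 * (1 / (n.choose 2 : ℝ) / 2) / 2, by positivity, ?_⟩
    filter_upwards [hae] with ω hω Xinf hXinf hKLX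
    obtain ⟨G, hG, hcount⟩ := hω
    have hle := hlim ω Xinf hXinf
    have hev := hKLX.eventually_rpow_le hf.continuous hclosed (fun t => hmem t ω) hXinf hle
      (by linarith [hσ.1]) (by linarith) hc
    have hsmall : ∀ᶠ t in atTop, f (X t ω) < f Xinf + 1 :=
      ((hf.continuous.tendsto Xinf).comp hXinf).eventually_lt_const (by linarith)
    -- Once the gap is below `1`, an exponent `σ ≤ 1/2` may be raised to `1/2` with the same
    -- constant.
    have hev' : ∀ᶠ t in atTop, (f (X t ω) - f Xinf) ^ (1 / 2 : ℝ) ≤ c * (1 - σ) * Metric.infDist 0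
        (JOBCD.limitingSubdiff (JOBCD.addIndicator f (JOBCD.JOrth J)) (X t ω)) := by
      filter_upwards [hev, hsmall] with t h1 h2
      exact (Real.rpow_le_rpow_of_exponent_ge' (sub_nonneg.2 (hle t)) (by linarith)
        (by linarith [hσ.1]) hσ.2).trans h1
    obtain ⟨C, T, hT⟩ := JOBCD.exists_sum_Ico_le_exp_of_KL (d := fun t => ‖V t ω - 1‖)
      (fun t => sub_nonneg.2 (hle t)) hθ (hdescΔ ω _) hq hcount hK₂ hG
      (by positivity) hev'
    refine ⟨K₁ * C, T, fun t ht => ?_⟩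
    have := JOBCD.dist_le_of_sum_Ico_le hXinf hK₁ (fun t => (hbd t ω).2.2) (hT t ht)
    rwa [dist_eq_norm, ← mul_assoc] at this
  · intro σ hσ τ hτ
    have hσ1 : 0 < 1 - σ := by linarith [hσ.2]
    filter_upwards [hae] with ω hω Xinf hXinf c hc hKLX
    obtain ⟨G, hG, hcount⟩ := hω
    have hle := hlim ω Xinf hXinf
    have hev := hKLX.eventually_rpow_le hf.continuous hclosed (fun t => hmem t ω) hXinf hle
      (by linarith [hσ.1]) hσ.2 hc
    obtain ⟨C, -, T, hT⟩ := JOBCD.exists_sum_Ico_le_of_KL (d := fun t => ‖V t ω - 1‖)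
      (fun t => sub_nonneg.2 (hle t)) (fun t => norm_nonneg _) hθ (hdescΔ ω _) hq hcount hK₂ hG
      hσ.1 hσ.2 (by positivity) hev
    refine ⟨K₁ * C, T, fun t ht => ?_⟩
    have h := JOBCD.dist_le_of_sum_Ico_le hXinf hK₁ (fun t => (hbd t ω).2.2) (hT t ht)
    have e : 1 / (t : ℝ) ^ (1 / τ) = (t : ℝ) ^ (-((1 - σ) / (2 * σ - 1))) := by
      rw [hτ, one_div_div, Real.rpow_neg t.cast_nonneg, one_div]
    rwa [dist_eq_norm, ← mul_assoc, ← e] at h
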